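/- Let $q\in\mathbb{C}$ be nonzero and not a root of unity. For $n\ge 1$, let $E_{ij}$ be the standard matrix units of $\operatorname{End}\mathbb{C}^n$ and $$R(u,v)=(u-v)\sum_{i\ne j}E_{ii}\otimes E_{jj}+(q^{-1}u-qv)\sum_iE_{ii}\otimes E_{ii}+(q^{-1}-q)u\sum_{i>j}E_{ij}\otimes E_{ji}+(q^{-1}-q)v\sum_{i<j}E_{ij}\otimes E_{ji}.$$ Let $U_q(\widehat{\mathfrak{gl}}_n)$ be the unital associative $\mathbb{C}$-algebra with generators $t_{ij}^{(r)},\bar t_{ij}^{(r)}$ ($1\le i,j\le n$, $r\ge 0$), combined into the matrices $T(u)=[t_{ij}(u)]$, $\overline T(u)=[\bar t_{ij}(u)]$ with $t_{ij}(u)=\sum_{r\ge0}t_{ij}^{(r)}u^{-r}$, $\bar t_{ij}(u)=\sum_{r\ge0}\bar t_{ij}^{(r)}u^{r}$, and with defining relations $$t_{ij}^{(0)}=\bar t_{ji}^{(0)}=0\quad(i<j),\qquad t_{ii}^{(0)}\bar t_{ii}^{(0)}=\bar t_{ii}^{(0)}t_{ii}^{(0)}=1,$$ $$R(u,v)T_1(u)T_2(v)=T_2(v)T_1(u)R(u,v),\qquad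 R(u,v)\overline T_1(u)\overline T_2(v)=\overline T_2(v)\overline T_1(u)R(u,v),$$ $$R(u,v)\overline T_1(u)T_2(v)=T_2(v)\overline T_1(u)R(u,v),$$ where $X_1=X\otimes1$ and $X_2=1\otimes X$. The $q$-Yangian $Y_q(\mathfrak{gl}_n)$ is the subalgebra of $U_q(\widehat{\mathfrak{gl}}_n)$ generated by all $t_{ij}^{(r)}$ and all $\bar t_{ii}^{(0)}$. For a square matrix $X(u)=[x_{ij}(u)]$ of formal series in $u^{-1}$ with coefficients in a $\mathbb{C}$-algebra, row indices $a_1<\dots<a_r$ and column indices $b_1,\dots,b_r$, the corresponding quantum minor of $X(u)$ is $$x^{a_1\cdots a_r}_{b_1\cdots b_r}(u)=\sum_{\sigma\in\mathfrak{S}_r}(-q)^{-l(\sigma)}\,x_{a_{\sigma(1)}b_1}(u)\,x_{a_{\sigma(2)}b_2}(q^{-2}u)\cdots x_{a_{\sigma(r)}b_r}(q^{-2r+2}u),$$ where $l(\sigma)$ is the number of inversions of $\sigma$. The quantum determinant $\operatorname{qdet}X(u)$ is the quantum minor with all rows and all columns (it is $1$ for the empty matrix). **Theorem (quantum Sylvester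 theorem).** Let $1\le m\le n$, let $T(u)$ be the generator matrix of $Y_q(\mathfrak{gl}_n)$, let $\mathcal{Q}=\{m+1,\dots,n\}$, and for $1\le i,j\le m$ let $t^{\flat}_{ij}(u)=t^{\,i,m+1,\dots,n}_{\,j,m+1,\dots,n}(u)$ be the quantum minor of $T(u)$ with rows $i,m+1,\dots,n$ and columns $j,m+1,\dots,n$. Put $T^{\flat}(u)=[t^{\flat}_{ij}(u)]_{i,j=1}^m$. Then there is a unique homomorphism of unital $\mathbb{C}$-algebras $Y_q(\mathfrak{gl}_m)\to Y_q(\mathfrak{gl}_n)$ such that $$t_{ij}(u)\mapsto t^{\flat}_{ij}(u)\qquad(1\le i,j\le m)$$ coefficientwise. Moreover, $$\operatorname{qdet}T^{\flat}(u)=\operatorname{qdet}T(u)\cdot\operatorname{qdet}T(q^{-2}u)_{\mathcal{Q}\mathcal{Q}}\cdots\operatorname{qdet}T(q^{-2m+2}u)_{\mathcal{Q}\mathcal{Q}},$$ where $T(u)_{\mathcal{Q}\mathcal{Q}}$ is the submatrix of $T(u)$ with rows and columns in $\mathcal{Q}$. -/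

import Mathlib

open scoped Kronecker PowerSeries

noncomputable section

namespace QuantumSylvester

/-! ### The trigonometric R-matrix -/

/-- The trigonometric R-matrix `R(u,v)` in `End ℂⁿ ⊗ End ℂⁿ`, at complex arguments `u`, `v`.
It is linear in the pair `(u,v)`: `R(u,v) = u R(1,0) + v R(0,1)`. -/
def rMatrix (q : ℂ) (n : ℕ) (u v : ℂ) : Matrix (Fin n × Fin n) (Fin n × Fin n) ℂ :=
  (u - v) • (∑ i, ∑ j, if i ≠ j then
      Matrix.single i i (1 : ℂ) ⊗ₖ Matrix.single j j (1 : ℂ) else 0)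
  + (q⁻¹ * u - q * v) • (∑ i, Matrix.single i i (1 : ℂ) ⊗ₖ Matrix.single i i (1 : ℂ))
  + ((q⁻¹ - q) * u) • (∑ i, ∑ j, if j < i then
      Matrix.single i j (1 : ℂ) ⊗ₖ Matrix.single j i (1 : ℂ) else 0)
  + ((q⁻¹ - q) * v) • (∑ i, ∑ j, if i < j then
      Matrix.single i j (1 : ℂ) ⊗ₖ Matrix.single j i (1 : ℂ) else 0)

section Series

variable {A : Type*} [Ring A] [Algebra ℂ A]

/-- `rMatrix`, with its entries regarded as scalars of the algebra `A`. -/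
def rMatrixIn (A : Type*) [Ring A] [Algebra ℂ A] (q : ℂ) (n : ℕ) (u v : ℂ) :
    Matrix (Fin n × Fin n) (Fin n × Fin n) A :=
  (rMatrix q n u v).map (algebraMap ℂ A)

/-- `X₁ = X ⊗ 1`. -/
def inFirst {n : ℕ} (X : Matrix (Fin n) (Fin n) A) :
    Matrix (Fin n × Fin n) (Fin n × Fin n) A :=
  X ⊗ₖ (1 : Matrix (Fin n) (Fin n) A)

/-- `X₂ = 1 ⊗ X`. -/
def inSecond {n : ℕ} (X : Matrix (Fin n) (Fin n) A) :
    Matrix (Fin n × Fin n) (Fin n × Fin n) A :=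
  (1 : Matrix (Fin n) (Fin n) A) ⊗ₖ X

/-- For `X(u) = ∑ₖ X k uᵏ` and `Y(v) = ∑ₗ Y l vˡ` (sums over `ℤ`), the coefficient of `uᵏ vˡ`
in `R(u,v) X₁(u) Y₂(v)`. -/
def rxyCoeff (q : ℂ) {n : ℕ} (X Y : ℤ → Matrix (Fin n) (Fin n) A) (k l : ℤ) :
    Matrix (Fin n × Fin n) (Fin n × Fin n) A :=
  rMatrixIn A q n 1 0 * inFirst (X (k - 1)) * inSecond (Y l)
  + rMatrixIn A q n 0 1 * inFirst (X k) * inSecond (Y (l - 1))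

/-- For `X(u) = ∑ₖ X k uᵏ` and `Y(v) = ∑ₗ Y l vˡ` (sums over `ℤ`), the coefficient of `uᵏ vˡ`
in `Y₂(v) X₁(u) R(u,v)`. -/
def yxrCoeff (q : ℂ) {n : ℕ} (X Y : ℤ → Matrix (Fin n) (Fin n) A) (k l : ℤ) :
    Matrix (Fin n × Fin n) (Fin n × Fin n) A :=
  inSecond (Y l) * inFirst (X (k - 1)) * rMatrixIn A q n 1 0
  + inSecond (Y (l - 1)) * inFirst (X k) * rMatrixIn A q n 0 1

end Series

/-! ### The quantum affine algebra `U_q(ĝl_n)` -/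

/-- The generators `t_ij^(r)` and `t̄_ij^(r)`, `r ≥ 0`. -/
inductive Gen (n : ℕ) : Type
  | t (i j : Fin n) (r : ℕ) : Gen n
  | tbar (i j : Fin n) (r : ℕ) : Gen n

/-- `freeT n k` is the coefficient of `uᵏ` in `T(u) = ∑_{r ≥ 0} T^(r) u⁻ʳ`. -/
def freeT (n : ℕ) (k : ℤ) : Matrix (Fin n) (Fin n) (FreeAlgebra ℂ (Gen n)) :=
  Matrix.of fun i j => if k ≤ 0 then FreeAlgebra.ι ℂ (Gen.t i j (-k).toNat) else 0

/-- `freeTbar n k` is the coefficient of `uᵏ` in `T̄(u) = ∑_{r ≥ 0} T̄^(r) uʳ`. -/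
def freeTbar (n : ℕ) (k : ℤ) : Matrix (Fin n) (Fin n) (FreeAlgebra ℂ (Gen n)) :=
  Matrix.of fun i j => if 0 ≤ k then FreeAlgebra.ι ℂ (Gen.tbar i j k.toNat) else 0

/-- The defining relations of `U_q(ĝl_n)`. -/
inductive AffineRel (q : ℂ) (n : ℕ) :
    FreeAlgebra ℂ (Gen n) → FreeAlgebra ℂ (Gen n) → Prop
  | t_zero (i j : Fin n) (h : i < j) :
      AffineRel q n (FreeAlgebra.ι ℂ (Gen.t i j 0)) 0
  | tbar_zero (i j : Fin n) (h : i < j) :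
      AffineRel q n (FreeAlgebra.ι ℂ (Gen.tbar j i 0)) 0
  | t_mul_tbar (i : Fin n) :
      AffineRel q n (FreeAlgebra.ι ℂ (Gen.t i i 0) * FreeAlgebra.ι ℂ (Gen.tbar i i 0)) 1
  | tbar_mul_t (i : Fin n) :
      AffineRel q n (FreeAlgebra.ι ℂ (Gen.tbar i i 0) * FreeAlgebra.ι ℂ (Gen.t i i 0)) 1
  | rtt (k l : ℤ) (a b : Fin n × Fin n) :
      AffineRel q n (rxyCoeff q (freeT n) (freeT n) k l a b)
        (yxrCoeff q (freeT n) (freeT n) k l a b)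
  | rtt_bar (k l : ℤ) (a b : Fin n × Fin n) :
      AffineRel q n (rxyCoeff q (freeTbar n) (freeTbar n) k l a b)
        (yxrCoeff q (freeTbar n) (freeTbar n) k l a b)
  | rtt_mixed (k l : ℤ) (a b : Fin n × Fin n) :
      AffineRel q n (rxyCoeff q (freeTbar n) (freeT n) k l a b)
        (yxrCoeff q (freeTbar n) (freeT n) k l a b)

/-- The quantum affine algebra `U_q(ĝl_n)` (with trivial central charge). -/
abbrev UqAffine (q : ℂ) (n : ℕ) : Type := RingQuot (AffineRel q n)

/-- The generator `t_ij^(r)` of `U_q(ĝl_n)`. -/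
def affT (q : ℂ) (n : ℕ) (i j : Fin n) (r : ℕ) : UqAffine q n :=
  RingQuot.mkAlgHom ℂ (AffineRel q n) (FreeAlgebra.ι ℂ (Gen.t i j r))

/-- The generator `t̄_ij^(r)` of `U_q(ĝl_n)`. -/
def affTbar (q : ℂ) (n : ℕ) (i j : Fin n) (r : ℕ) : UqAffine q n :=
  RingQuot.mkAlgHom ℂ (AffineRel q n) (FreeAlgebra.ι ℂ (Gen.tbar i j r))

/-! ### The `q`-Yangian -/

/-- The `q`-Yangian `Y_q(gl_n)`: the subalgebra of `U_q(ĝl_n)` generated by all `t_ij^(r)` and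
all `t̄_ii^(0)`. -/
def qYangian (q : ℂ) (n : ℕ) : Subalgebra ℂ (UqAffine q n) :=
  Algebra.adjoin ℂ ({x | ∃ i j r, x = affT q n i j r} ∪ {x | ∃ i, x = affTbar q n i i 0})

/-- The generator `t_ij^(r)`, as an element of `Y_q(gl_n)`. -/
def yangT (q : ℂ) (n : ℕ) (i j : Fin n) (r : ℕ) : qYangian q n :=
  ⟨affT q n i j r, Algebra.subset_adjoin (Or.inl ⟨i, j, r, rfl⟩)⟩

/-- The generator matrix `T(u) = [t_ij(u)]` over `Y_q(gl_n)`. A formal series `∑_r x_r u⁻ʳ` is the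
power series `∑_r x_r Xʳ`; that is, the variable is `X = u⁻¹`. -/
def yangMatrix (q : ℂ) (n : ℕ) : Matrix (Fin n) (Fin n) (qYangian q n)⟦X⟧ :=
  Matrix.of fun i j => PowerSeries.mk fun r => yangT q n i j r

/-! ### Quantum minors and quantum determinants -/

/-- The length `l(σ)`: the number of inversions. -/
def permLength {r : ℕ} (σ : Equiv.Perm (Fin r)) : ℕ :=
  (Finset.univ.filter fun p : Fin r × Fin r => p.1 < p.2 ∧ σ p.2 < σ p.1).card

section Minors

variable {A : Type*} [Ring A] [Algebra ℂ A]

/-- For `f = ∑_r x_r u⁻ʳ`, the series `f(αu) = ∑_r α⁻ʳ x_r u⁻ʳ`, for `α ≠ 0`. -/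
def scaleArg (α : ℂ) (f : A⟦X⟧) : A⟦X⟧ :=
  PowerSeries.mk fun r => (α⁻¹ ^ r) • PowerSeries.coeff r f

/-- The quantum minor
`∑_σ (-q)^{-l(σ)} x_{a_σ(1) b_1}(u) x_{a_σ(2) b_2}(q⁻²u) ⋯ x_{a_σ(r) b_r}(q^{-2r+2}u)`
of a matrix of series `[x_ij(u)]`, with rows `a_1 < ⋯ < a_r` and columns `b_1, …, b_r`.
(The indices `k : Fin r` start from `0`; the product is ordered from left to right.) -/
def qMinor (q : ℂ) {n r : ℕ} (M : Matrix (Fin n) (Fin n) A⟦X⟧) (a b : Fin r → Fin n) : A⟦X⟧ :=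
  ∑ σ : Equiv.Perm (Fin r), (-q) ^ (-(permLength σ : ℤ)) •
    (List.ofFn fun k : Fin r => scaleArg (q ^ (-2 * (k : ℤ))) (M (a (σ k)) (b k))).prod

/-- The quantum determinant: the quantum minor with all rows and all columns. -/
def qDet (q : ℂ) {n : ℕ} (M : Matrix (Fin n) (Fin n) A⟦X⟧) : A⟦X⟧ :=
  qMinor q M id id

/-- The increasing enumeration of the last `n - m` indices `𝒬 = {m+1, …, n}`. -/
def lastIdx {m n : ℕ} (hmn : m ≤ n) : Fin (n - m) → Fin n :=
  fun k => ⟨m + k, by have := k.isLt; omega⟩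

/-- The sequence of indices `i, m+1, …, n`, where `1 ≤ i ≤ m`. -/
def flatIdx {m n : ℕ} (hmn : m ≤ n) (i : Fin m) : Fin (n - m + 1) → Fin n :=
  Fin.cons (Fin.castLE hmn i) (lastIdx hmn)

/-- The matrix `T^♭(u)`, whose `(i,j)` entry is the quantum minor with rows `i, m+1, …, n` and
columns `j, m+1, …, n`. -/
def flatMatrix (q : ℂ) {m n : ℕ} (hmn : m ≤ n) (M : Matrix (Fin n) (Fin n) A⟦X⟧) :
    Matrix (Fin m) (Fin m) A⟦X⟧ :=
  Matrix.of fun i j => qMinor q M (flatIdx hmn i) (flatIdx hmn j)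

/-- The submatrix with rows and columns in `𝒬 = {m+1, …, n}`. -/
def lastBlock {m n : ℕ} (hmn : m ≤ n) (M : Matrix (Fin n) (Fin n) A⟦X⟧) :
    Matrix (Fin (n - m)) (Fin (n - m)) A⟦X⟧ :=
  M.submatrix (lastIdx hmn) (lastIdx hmn)

end Minors

end QuantumSylvester

end

/-! The proof runs through Schur complements (quasideterminants). Put P = {1,…,m}, s = n − m, D(u) =
qdet T(u)_QQ and S = T_PP − T_PQ T_QQ⁻¹ T_QP; the inverse exists because the constant terms are
triangular with invertible diagonal. At v = q⁻²u the R-matrix degenerates, so quantum minors are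
q-antisymmetric in their columns (`RTT.colAntisymm`). A Cramer-type argument then gives T♭_ij(u) =
D(u) S_ij(q^{-2s}u) (`minor_cons`).

S is the inverse of the PP-block of T⁻¹. Inversion reverses the order of factors in the exchange
relation, the reversed relation restricts to blocks, and a second inversion returns the original
relation for S (`RTT.schur`). Inverting only one factor shows that entries of (T⁻¹)_PP commute with
those of T_QQ; hence D commutes with S, and an induction shows that D commutes with its own shifts.
So D(u)S(q^{-2s}u) again satisfies the exchange relation (`LaxPair.rtt_flat`).

The q-Yangian is given as a subalgebra, not by a presentation. The homomorphism is therefore built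
on all of U_q(ĝl_m): the same reasoning applies to T̄ and to the mixed relation, so (T♭, T̄♭)
satisfies every defining relation (`AffinePair.flat`). Restriction lands in the q-Yangian because
the constant term of t̄♭_ii is a product of elements t̄_kk^(0). Uniqueness holds since t̄_ii^(0) is
inverse to t_ii^(0).

For the determinant, the factors D can be pulled out, so qdet T♭(u) = D(u)D(q⁻²u)⋯D(q^{-2m+2}u) qdet
S(q^{-2s}u), and D(u) qdet S(q^{-2s}u) = qdet T(u) by `IsLax.minor_eq_mul_schur`. -/

noncomputable section

namespace QuantumSylvester

set_option linter.unusedSectionVars false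

/-! ### The exchange relation over a ring: inversion, unitarity, commuting blocks -/

section ExchangeRelation

variable {B : Type*} [Ring B] [Algebra ℂ B]

/-- The diagonal entry of the R-matrix in position `((a,b),(a,b))`, where `α`, `β` stand for the
spectral parameters `u`, `v`. -/
def rDiag (q : ℂ) (α β : B) {n : ℕ} (a b : Fin n) : B :=
  if a = b then q⁻¹ • α - q • β else α - β

/-- The off-diagonal entry of the R-matrix in position `((a,b),(b,a))`. -/
def rOff (q : ℂ) (α β : B) {n : ℕ} (a b : Fin n) : B :=
  if a = b then 0 else (q⁻¹ - q) • (if b < a then α else β)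

/-- The R-matrix with arbitrary ring elements as spectral parameters. -/
def rMat (q : ℂ) (α β : B) (n : ℕ) : Matrix (Fin n × Fin n) (Fin n × Fin n) B :=
  Matrix.of fun x y => (if x = y then rDiag q α β x.1 x.2 else 0) +
    (if x = y.swap then rOff q α β x.1 x.2 else 0)

/-- The relation `R(α,β) X₁ Y₂ = Y₂ X₁ R(α,β)`, written out in matrix entries. -/
def RTT (q : ℂ) (α β : B) {n : ℕ} (X Y : Matrix (Fin n) (Fin n) B) : Prop :=
  ∀ a b c d, rDiag q α β a b * (X a c * Y b d) + rOff q α β a b * (X b c * Y a d) =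
    Y b d * X a c * rDiag q α β c d + Y b c * X a d * rOff q α β d c

/-- The relation `X₁ Y₂ R(α,β) = R(α,β) Y₂ X₁`, written out in matrix entries. -/
def OpRTT (q : ℂ) (α β : B) {n : ℕ} (X Y : Matrix (Fin n) (Fin n) B) : Prop :=
  ∀ a b c d, X a c * Y b d * rDiag q α β c d + X a d * Y b c * rOff q α β d c =
    rDiag q α β a b * (Y b d * X a c) + rOff q α β a b * (Y a d * X b c)

theorem rMat_mul_apply (q : ℂ) (α β : B) {n : ℕ} (M : Matrix (Fin n × Fin n) (Fin n × Fin n) B)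
    (a b : Fin n) (z : Fin n × Fin n) :
    (rMat q α β n * M) (a, b) z =
      rDiag q α β a b * M (a, b) z + rOff q α β a b * M (b, a) z := by
  simp only [Matrix.mul_apply, rMat, Matrix.of_apply, add_mul, Finset.sum_add_distrib, ite_mul,
    zero_mul]
  congr 1
  · simp
  · rw [Finset.sum_eq_single (b, a)]
    · simp
    · rintro ⟨c, d⟩ _ h
      rw [if_neg]
      rintro h'
      simp only [Prod.swap_prod_mk, Prod.mk.injEq] at h'
      exact h (by rw [h'.1, h'.2])
    · simp

theorem mul_rMat_apply (q : ℂ) (α β : B) {n : ℕ} (M : Matrix (Fin n × Fin n) (Fin n × Fin n) B)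
    (z : Fin n × Fin n) (c d : Fin n) :
    (M * rMat q α β n) z (c, d) =
      M z (c, d) * rDiag q α β c d + M z (d, c) * rOff q α β d c := by
  simp [Matrix.mul_apply, rMat, mul_add, Finset.sum_add_distrib]

theorem inFirst_mul_inSecond_apply {n : ℕ} (X Y : Matrix (Fin n) (Fin n) B) (a b c d : Fin n) :
    (inFirst X * inSecond Y) (a, b) (c, d) = X a c * Y b d := by
  simp only [Matrix.mul_apply, inFirst, inSecond, Matrix.kroneckerMap_apply, Fintype.sum_prod_type]
  simp [Matrix.one_apply]

theorem inSecond_mul_inFirst_apply {n : ℕ} (X Y : Matrix (Fin n) (Fin n) B) (a b c d : Fin n) :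
    (inSecond Y * inFirst X) (a, b) (c, d) = Y b d * X a c := by
  simp only [Matrix.mul_apply, inFirst, inSecond, Matrix.kroneckerMap_apply, Fintype.sum_prod_type]
  simp [Matrix.one_apply]

theorem inFirst_mul {n : ℕ} (X Y : Matrix (Fin n) (Fin n) B) :
    inFirst (X * Y) = inFirst X * inFirst Y := by
  ext ⟨a, b⟩ ⟨c, d⟩
  simp only [Matrix.mul_apply, inFirst, Matrix.kroneckerMap_apply, Fintype.sum_prod_type]
  simp [Matrix.one_apply]

theorem inSecond_mul {n : ℕ} (X Y : Matrix (Fin n) (Fin n) B) :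
    inSecond (X * Y) = inSecond X * inSecond Y := by
  ext ⟨a, b⟩ ⟨c, d⟩
  simp only [Matrix.mul_apply, inSecond, Matrix.kroneckerMap_apply, Fintype.sum_prod_type]
  simp [Matrix.one_apply, Finset.mul_sum]

theorem inFirst_one {n : ℕ} : inFirst (1 : Matrix (Fin n) (Fin n) B) = 1 := by
  ext ⟨a, b⟩ ⟨c, d⟩
  simp [inFirst, Matrix.one_apply, ← ite_and, and_comm]

theorem inSecond_one {n : ℕ} : inSecond (1 : Matrix (Fin n) (Fin n) B) = 1 := by
  ext ⟨a, b⟩ ⟨c, d⟩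
  simp [inSecond, Matrix.one_apply, ← ite_and, and_comm]

theorem rtt_iff {q : ℂ} {α β : B} {n : ℕ} {X Y : Matrix (Fin n) (Fin n) B} :
    RTT q α β X Y ↔
      rMat q α β n * (inFirst X * inSecond Y) = inSecond Y * inFirst X * rMat q α β n := by
  simp only [← Matrix.ext_iff, Prod.forall, rMat_mul_apply, mul_rMat_apply,
    inFirst_mul_inSecond_apply, inSecond_mul_inFirst_apply]
  rfl

theorem opRTT_iff {q : ℂ} {α β : B} {n : ℕ} {X Y : Matrix (Fin n) (Fin n) B} :
    OpRTT q α β X Y ↔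
      inFirst X * inSecond Y * rMat q α β n = rMat q α β n * (inSecond Y * inFirst X) := by
  simp only [← Matrix.ext_iff, Prod.forall, rMat_mul_apply, mul_rMat_apply,
    inFirst_mul_inSecond_apply, inSecond_mul_inFirst_apply]
  rfl

theorem rDiag_comp (q : ℂ) (α β : B) {n m : ℕ} {f : Fin m → Fin n} (hf : StrictMono f)
    (a b : Fin m) : rDiag q α β (f a) (f b) = rDiag q α β a b := by
  simp [rDiag, hf.injective.eq_iff]

theorem rOff_comp (q : ℂ) (α β : B) {n m : ℕ} {f : Fin m → Fin n} (hf : StrictMono f)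
    (a b : Fin m) : rOff q α β (f a) (f b) = rOff q α β a b := by
  simp [rOff, hf.injective.eq_iff, hf.lt_iff_lt]

/-- The entries of R depend only on the relative order of the indices, and R never leaves the span
of a pair and its swap. -/
theorem RTT.submatrix {q : ℂ} {α β : B} {n m : ℕ} {X Y : Matrix (Fin n) (Fin n) B}
    (h : RTT q α β X Y) {f : Fin m → Fin n} (hf : StrictMono f) :
    RTT q α β (X.submatrix f f) (Y.submatrix f f) := by
  intro a b c d
  simpa [rDiag_comp q α β hf, rOff_comp q α β hf] using h (f a) (f b) (f c) (f d)

theorem OpRTT.submatrix {q : ℂ} {α β : B} {n m : ℕ} {X Y : Matrix (Fin n) (Fin n) B}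
    (h : OpRTT q α β X Y) {f : Fin m → Fin n} (hf : StrictMono f) :
    OpRTT q α β (X.submatrix f f) (Y.submatrix f f) := by
  intro a b c d
  simpa [rDiag_comp q α β hf, rOff_comp q α β hf] using h (f a) (f b) (f c) (f d)

/-- Multiply by X₁⁻¹Y₂⁻¹ on the left and Y₂⁻¹X₁⁻¹ on the right. R itself is not inverted, so its
parameters are unrestricted. -/
theorem RTT.inverse {q : ℂ} {α β : B} {n : ℕ} {X Y X' Y' : Matrix (Fin n) (Fin n) B}
    (h : RTT q α β X Y) (hX : X * X' = 1) (hX' : X' * X = 1) (hY : Y * Y' = 1)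
    (hY' : Y' * Y = 1) : OpRTT q α β X' Y' := by
  rw [rtt_iff] at h
  rw [opRTT_iff]
  have e1 : inFirst X * inFirst X' = 1 := by rw [← inFirst_mul, hX, inFirst_one]
  have e2 : inFirst X' * inFirst X = 1 := by rw [← inFirst_mul, hX', inFirst_one]
  have e3 : inSecond Y * inSecond Y' = 1 := by rw [← inSecond_mul, hY, inSecond_one]
  have e4 : inSecond Y' * inSecond Y = 1 := by rw [← inSecond_mul, hY', inSecond_one]
  generalize inFirst X = x at *
  generalize inFirst X' = x' at *
  generalize inSecond Y = y at *
  generalize inSecond Y' = y' at *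
  generalize rMat q α β n = r at *
  calc x' * y' * r = x' * y' * (r * (x * y)) * (y' * x') := by
        have : x * y * (y' * x') = 1 := by
          rw [mul_assoc, ← mul_assoc y, e3, one_mul, e1]
        rw [mul_assoc (x' * y'), mul_assoc r, this, mul_one]
    _ = r * (y' * x') := by
        have : x' * y' * (y * x) = 1 := by
          rw [mul_assoc, ← mul_assoc y', e4, one_mul, e2]
        rw [h, ← mul_assoc (x' * y'), this, one_mul]

theorem OpRTT.inverse {q : ℂ} {α β : B} {n : ℕ} {X Y X' Y' : Matrix (Fin n) (Fin n) B}
    (h : OpRTT q α β X Y) (hX : X * X' = 1) (hX' : X' * X = 1) (hY : Y * Y' = 1)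
    (hY' : Y' * Y = 1) : RTT q α β X' Y' := by
  rw [opRTT_iff] at h
  rw [rtt_iff]
  have e1 : inFirst X * inFirst X' = 1 := by rw [← inFirst_mul, hX, inFirst_one]
  have e2 : inFirst X' * inFirst X = 1 := by rw [← inFirst_mul, hX', inFirst_one]
  have e3 : inSecond Y * inSecond Y' = 1 := by rw [← inSecond_mul, hY, inSecond_one]
  have e4 : inSecond Y' * inSecond Y = 1 := by rw [← inSecond_mul, hY', inSecond_one]
  generalize inFirst X = x at *
  generalize inFirst X' = x' at *
  generalize inSecond Y = y at *
  generalize inSecond Y' = y' at *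
  generalize rMat q α β n = r at *
  calc r * (x' * y') = y' * x' * (x * y * r) * (x' * y') := by
        have : y' * x' * (x * y) = 1 := by
          rw [mul_assoc, ← mul_assoc x', e2, one_mul, e4]
        rw [← mul_assoc (y' * x'), this, one_mul]
    _ = y' * x' * r := by
        have : y * x * (x' * y') = 1 := by
          rw [mul_assoc, ← mul_assoc x, e1, one_mul, e3]
        rw [h, mul_assoc (y' * x'), mul_assoc r, this, mul_one]

/-- `α`, `β` are central, and the factors of `R` that have to be cancelled are not zero
divisors. -/
structure Spectral (q : ℂ) (α β : B) : Prop where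
  left_comm : ∀ z, Commute α z
  right_comm : ∀ z, Commute β z
  reg_sub : ∀ z, (α - β) * z = 0 → z = 0
  reg_left : ∀ z, (q⁻¹ • α - q • β) * z = 0 → z = 0
  reg_right : ∀ z, (q⁻¹ • β - q • α) * z = 0 → z = 0

theorem Spectral.symm {q : ℂ} {α β : B} (h : Spectral q α β) : Spectral q β α where
  left_comm := h.right_comm
  right_comm := h.left_comm
  reg_sub z hz := h.reg_sub z (by rw [← neg_sub, neg_mul, hz, neg_zero])
  reg_left := h.reg_right
  reg_right := h.reg_left

theorem Spectral.rDiag_comm {q : ℂ} {α β : B} (h : Spectral q α β) {n : ℕ} (a b : Fin n) (z : B) :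
    Commute (rDiag q α β a b) z := by
  unfold rDiag
  split
  · exact ((h.left_comm z).smul_left _).sub_left ((h.right_comm z).smul_left _)
  · exact (h.left_comm z).sub_left (h.right_comm z)

theorem Spectral.rOff_comm {q : ℂ} {α β : B} (h : Spectral q α β) {n : ℕ} (a b : Fin n) (z : B) :
    Commute (rOff q α β a b) z := by
  unfold rOff
  split_ifs
  · exact Commute.zero_left z
  · exact (h.left_comm z).smul_left _
  · exact (h.right_comm z).smul_left _

theorem Spectral.eq_of_mul {q : ℂ} {α β : B} (h : Spectral q α β) {z w : B}
    (e : (q⁻¹ • α - q • β) * ((q⁻¹ • β - q • α) * z) =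
      (q⁻¹ • α - q • β) * ((q⁻¹ • β - q • α) * w)) : z = w := by
  rw [← sub_eq_zero]
  apply h.reg_right
  apply h.reg_left
  rw [mul_sub, mul_sub, e, sub_self]

/-- The R-matrix with the two tensor factors interchanged. -/
def rMatFlip (q : ℂ) (α β : B) (n : ℕ) : Matrix (Fin n × Fin n) (Fin n × Fin n) B :=
  Matrix.of fun x y => rMat q α β n x.swap y.swap

theorem rMatFlip_apply (q : ℂ) (α β : B) {n : ℕ} (a b c d : Fin n) :
    rMatFlip q α β n (a, b) (c, d) =
      (if a = c ∧ b = d then rDiag q α β a b else 0) +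
        (if a = d ∧ b = c then rOff q α β b a else 0) := by
  simp only [rMatFlip, rMat, Matrix.of_apply, Prod.swap_prod_mk, Prod.mk.injEq, rDiag]
  simp only [and_comm, eq_comm]

theorem rMat_apply (q : ℂ) (α β : B) {n : ℕ} (a b c d : Fin n) :
    rMat q α β n (a, b) (c, d) =
      (if a = c ∧ b = d then rDiag q α β a b else 0) +
        (if a = d ∧ b = c then rOff q α β a b else 0) := by
  simp only [rMat, Matrix.of_apply, Prod.swap_prod_mk, Prod.mk.injEq]

theorem rMatFlip_mul_apply (q : ℂ) (α β : B) {n : ℕ}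
    (M : Matrix (Fin n × Fin n) (Fin n × Fin n) B) (a b : Fin n) (z : Fin n × Fin n) :
    (rMatFlip q α β n * M) (a, b) z =
      rDiag q α β a b * M (a, b) z + rOff q α β b a * M (b, a) z := by
  simp only [Matrix.mul_apply, Fintype.sum_prod_type, rMatFlip_apply, add_mul,
    Finset.sum_add_distrib, ite_and, ite_mul, zero_mul]
  simp

theorem mul_rMatFlip_apply (q : ℂ) (α β : B) {n : ℕ}
    (M : Matrix (Fin n × Fin n) (Fin n × Fin n) B) (z : Fin n × Fin n) (c d : Fin n) :
    (M * rMatFlip q α β n) z (c, d) =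
      M z (c, d) * rDiag q α β c d + M z (d, c) * rOff q α β c d := by
  simp only [Matrix.mul_apply, Fintype.sum_prod_type, rMatFlip_apply, mul_add,
    Finset.sum_add_distrib, ite_and, mul_ite, mul_zero]
  simp

theorem rDiag_sq_add_rOff_sq {q : ℂ} (hq : q ≠ 0) {α β : B} (h : Commute α β) {n : ℕ}
    (a b : Fin n) :
    rDiag q β α a b * rDiag q α β a b + rOff q β α a b * rOff q α β a b =
      (q⁻¹ • α - q • β) * (q⁻¹ • β - q • α) := by
  have hc : β * α = α * β := h.eq.symm
  have hq' : q⁻¹ * q = 1 := inv_mul_cancel₀ hq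
  have hq'' : q * q⁻¹ = 1 := mul_inv_cancel₀ hq
  unfold rDiag rOff
  by_cases hab : a = b
  · simp only [hab, if_true, mul_zero, add_zero]
    simp only [mul_sub, sub_mul, smul_mul_smul_comm, hc, hq', hq'']
    abel
  · simp only [hab, if_false]
    have key : (β - α) * (α - β) + ((q⁻¹ - q) * (q⁻¹ - q)) • (α * β) =
        (q⁻¹ • α - q • β) * (q⁻¹ • β - q • α) := by
      simp only [mul_sub, sub_mul, smul_mul_smul_comm, hc, hq', hq'', sub_smul, one_smul]
      abel
    split_ifs <;> simp only [smul_mul_smul_comm, hc, ← key]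

theorem rDiag_mul_rOff_add (q : ℂ) {α β : B} (h : Commute α β) {n : ℕ}
    (a b : Fin n) :
    rDiag q β α a b * rOff q α β b a + rOff q β α a b * rDiag q α β a b = 0 := by
  have hc : β * α = α * β := h.eq.symm
  unfold rDiag rOff
  by_cases hab : a = b
  · simp [hab]
  · rcases lt_or_gt_of_ne hab with hlt | hlt
    all_goals
      simp only [hab, Ne.symm hab, if_false, hlt, hlt.not_gt, if_true, mul_smul_comm,
        smul_mul_assoc, sub_mul, mul_sub, hc, smul_sub]
      abel

theorem rDiag_swap (q : ℂ) (α β : B) {n : ℕ} (a b : Fin n) :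
    rDiag q α β a b = rDiag q α β b a := by
  simp only [rDiag, eq_comm]

/-- Both factors preserve the span of e_a ⊗ e_b and e_b ⊗ e_a, so unitarity reduces to the two
preceding scalar identities. -/
theorem rMat_mul_rMatFlip {q : ℂ} (hq : q ≠ 0) {α β : B} (h : Spectral q α β) (n : ℕ) :
    rMat q β α n * rMatFlip q α β n =
      Matrix.diagonal fun _ => (q⁻¹ • α - q • β) * (q⁻¹ • β - q • α) := by
  ext ⟨a, b⟩ ⟨c, d⟩
  rw [rMat_mul_apply, rMatFlip_apply, rMatFlip_apply, Matrix.diagonal_apply]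
  have h1 := rDiag_sq_add_rOff_sq hq (h.left_comm β) a b
  have h2 := rDiag_mul_rOff_add q (h.left_comm β) a b
  rw [← h1, rDiag_swap q α β b a]
  simp only [mul_add, mul_ite, mul_zero, Prod.mk.injEq]
  by_cases hab : a = b
  · subst hab
    by_cases hc : a = c <;> by_cases hd : a = d <;> simp [hc, hd, rOff]
  · by_cases hcd : a = c ∧ b = d
    · obtain ⟨rfl, rfl⟩ := hcd
      simp [hab, Ne.symm hab]
    · by_cases hcd' : a = d ∧ b = c
      · obtain ⟨rfl, rfl⟩ := hcd'
        simp [hab, Ne.symm hab, h2]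
      · simp [hcd, hcd', and_comm]

theorem rMatFlip_mul_rMat {q : ℂ} (hq : q ≠ 0) {α β : B} (h : Spectral q α β) (n : ℕ) :
    rMatFlip q α β n * rMat q β α n =
      Matrix.diagonal fun _ => (q⁻¹ • α - q • β) * (q⁻¹ • β - q • α) := by
  have hc : Commute (q⁻¹ • α - q • β) (q⁻¹ • β - q • α) :=
    ((h.left_comm _).smul_left _).sub_left ((h.right_comm _).smul_left _)
  rw [hc.eq]
  ext x y
  have e := congrFun (congrFun (rMat_mul_rMatFlip hq h.symm n) x.swap) y.swap
  rw [Matrix.diagonal_apply] at e ⊢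
  rw [Matrix.mul_apply, ← (Equiv.prodComm (Fin n) (Fin n)).sum_comp] at e
  simpa [Matrix.mul_apply, rMatFlip] using e

/-- Unitarity of the R-matrix: the relation for `X₁`, `Y₂` is the one for `Y₁`, `X₂` with the
spectral parameters interchanged. -/
theorem RTT.swap {q : ℂ} (hq : q ≠ 0) {α β : B} (hs : Spectral q α β) {n : ℕ}
    {X Y : Matrix (Fin n) (Fin n) B} (h : RTT q α β X Y) : RTT q β α Y X := by
  -- The hypothesis conjugated by the flip of the tensor factors.
  have h1 : rMatFlip q α β n * (inSecond X * inFirst Y) =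
      inFirst Y * inSecond X * rMatFlip q α β n := by
    ext ⟨a, b⟩ ⟨c, d⟩
    rw [rMatFlip_mul_apply, mul_rMatFlip_apply]
    simp only [inFirst_mul_inSecond_apply, inSecond_mul_inFirst_apply]
    have := h b a d c
    rw [rDiag_swap q α β b a, rDiag_swap q α β d c] at this
    exact this
  -- Between two copies of R(β,α), the flipped R becomes by unitarity the same central scalar on
  -- both sides, and this scalar can be cancelled.
  have h2 : rMat q β α n * (rMatFlip q α β n * (inSecond X * inFirst Y)) * rMat q β α n =
      rMat q β α n * (inFirst Y * inSecond X * rMatFlip q α β n) * rMat q β α n := by rw [h1]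
  rw [← mul_assoc (rMat q β α n), rMat_mul_rMatFlip hq hs, ← mul_assoc (rMat q β α n),
    mul_assoc _ (rMatFlip q α β n), rMatFlip_mul_rMat hq hs, mul_assoc] at h2
  rw [rtt_iff]
  ext x y
  have h3 := congrFun (congrFun h2 x) y
  rw [Matrix.diagonal_mul, Matrix.mul_diagonal] at h3
  apply hs.eq_of_mul
  have hc : ∀ z, Commute ((q⁻¹ • α - q • β) * (q⁻¹ • β - q • α)) z := fun z =>
    (((hs.left_comm z).smul_left _).sub_left ((hs.right_comm z).smul_left _)).mul_left
      (((hs.right_comm z).smul_left _).sub_left ((hs.left_comm z).smul_left _))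
  rw [← (hc _).eq] at h3
  simpa only [mul_assoc] using h3.symm

/-- Entries of `Y⁻¹` and of `X` in complementary blocks commute. -/
theorem RTT.inverse_right_comm {q : ℂ} {α β : B} (hs : Spectral q α β) {n : ℕ}
    {X Y Y' : Matrix (Fin n) (Fin n) B} (h : RTT q α β X Y) (hY : Y * Y' = 1) (hY' : Y' * Y = 1)
    {a b c d : Fin n} (had : a ≠ d) (hbc : b ≠ c) : Commute (Y' b d) (X a c) := by
  rw [rtt_iff] at h
  have e3 : inSecond Y * inSecond Y' = 1 := by rw [← inSecond_mul, hY, inSecond_one]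
  have e4 : inSecond Y' * inSecond Y = 1 := by rw [← inSecond_mul, hY', inSecond_one]
  -- Only one factor is inverted: Y₂⁻¹RX₁ = X₁RY₂⁻¹. In the entry at (a,b), (c,d), the conditions a
  -- ≠ d and b ≠ c remove the off-diagonal part of R and leave the common factor α − β.
  have h1 : inSecond Y' * (rMat q α β n * inFirst X) =
      inFirst X * rMat q α β n * inSecond Y' := by
    calc _ = inSecond Y' * (rMat q α β n * (inFirst X * inSecond Y)) * inSecond Y' := by
          simp only [mul_assoc, e3, mul_one]
      _ = _ := by
          rw [h]
          simp only [← mul_assoc, e4, one_mul]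
  have h2 := congrFun (congrFun h1 (a, b)) (c, d)
  simp only [Matrix.mul_apply (M := inSecond Y'), Matrix.mul_apply (N := inSecond Y'),
    Fintype.sum_prod_type, rMat_mul_apply, mul_rMat_apply] at h2
  simp only [inFirst, inSecond, Matrix.kroneckerMap_apply, Matrix.one_apply] at h2
  simp [had, hbc] at h2
  rw [← (hs.rDiag_comm c b _).eq, ← mul_assoc, ← (hs.rDiag_comm a d _).eq, mul_assoc, mul_assoc]
    at h2
  simp only [rDiag, had, hbc.symm, if_false] at h2
  rw [Commute, SemiconjBy, ← sub_eq_zero]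
  apply hs.reg_sub
  rw [mul_sub, h2, sub_self]

/-- A `1 × 1` solution of the exchange relation consists of commuting elements. -/
theorem RTT.comm_of_one {q : ℂ} {α β : B} (hs : Spectral q α β)
    {X Y : Matrix (Fin 1) (Fin 1) B} (h : RTT q α β X Y) : Commute (X 0 0) (Y 0 0) := by
  have h1 := h 0 0 0 0
  rw [← (hs.rDiag_comm _ _ _).eq] at h1
  simp only [rDiag, rOff, if_true, zero_mul, mul_zero, add_zero] at h1
  rw [Commute, SemiconjBy, ← sub_eq_zero]
  apply hs.reg_left
  rw [mul_sub, h1, sub_self]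

end ExchangeRelation

/-! ### Functoriality and homogeneity of the exchange relation -/

section ExchangeRelationMaps

variable {B B' : Type*} [Ring B] [Algebra ℂ B] [Ring B'] [Algebra ℂ B']

theorem RTT.map {q : ℂ} {α β : B} {n : ℕ} {X Y : Matrix (Fin n) (Fin n) B}
    (h : RTT q α β X Y) (φ : B →ₐ[ℂ] B') : RTT q (φ α) (φ β) (X.map φ) (Y.map φ) := by
  intro a b c d
  have h1 : ∀ a b : Fin n, φ (rDiag q α β a b) = rDiag q (φ α) (φ β) a b := by
    intro a b; unfold rDiag; split <;> simp
  have h2 : ∀ a b : Fin n, φ (rOff q α β a b) = rOff q (φ α) (φ β) a b := by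
    intro a b; unfold rOff; split_ifs <;> simp
  simpa [h1, h2] using congrArg φ (h a b c d)

theorem rDiag_smul (q k : ℂ) (α β : B) {n : ℕ} (a b : Fin n) :
    rDiag q (k • α) (k • β) a b = k • rDiag q α β a b := by
  unfold rDiag; split <;> simp only [smul_sub, smul_comm k]

theorem rOff_smul (q k : ℂ) (α β : B) {n : ℕ} (a b : Fin n) :
    rOff q (k • α) (k • β) a b = k • rOff q α β a b := by
  unfold rOff; split_ifs <;> simp [smul_comm k]

theorem RTT.of_smul {q k : ℂ} (hk : k ≠ 0) {α β : B} {n : ℕ} {X Y : Matrix (Fin n) (Fin n) B}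
    (h : RTT q (k • α) (k • β) X Y) : RTT q α β X Y := by
  intro a b c d
  have := h a b c d
  simp only [rDiag_smul, rOff_smul, smul_mul_assoc, mul_smul_comm, ← smul_add] at this
  exact smul_right_injective B hk this

end ExchangeRelationMaps

/-! ### Series in two variables, rescaling, and specialization at v = q⁻²u -/

section TwoVariables

variable {A : Type*} [Ring A] [Algebra ℂ A]

open PowerSeries

/-- The substitution `X ↦ cX` in a power series. -/
def scale (c : ℂ) : A⟦X⟧ →ₐ[ℂ] A⟦X⟧ :=
  AlgHom.ofLinearMap
    { toFun := fun f => PowerSeries.mk fun r => c ^ r • PowerSeries.coeff r f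
      map_add' := fun f g => by ext; simp
      map_smul' := fun k f => by
        ext r
        simp only [coeff_mk, RingHom.id_apply, PowerSeries.coeff_smul]
        exact smul_comm _ _ _ }
    (by
      ext r
      simp only [LinearMap.coe_mk, AddHom.coe_mk, coeff_mk, coeff_one]
      split_ifs with h
      · simp [h]
      · simp)
    (fun f g => by
      ext r
      simp only [LinearMap.coe_mk, AddHom.coe_mk, coeff_mk, coeff_mul, Finset.smul_sum]
      refine Finset.sum_congr rfl fun x hx => ?_
      rw [smul_mul_smul_comm, ← pow_add, Finset.HasAntidiagonal.mem_antidiagonal.1 hx])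

@[simp]
theorem coeff_scale (c : ℂ) (f : A⟦X⟧) (r : ℕ) : coeff r (scale c f) = c ^ r • coeff r f := by
  simp [scale]

theorem scale_scale (c d : ℂ) (f : A⟦X⟧) : scale c (scale d f) = scale (c * d) f := by
  ext r
  simp [mul_pow, mul_smul]

theorem scale_one (f : A⟦X⟧) : scale 1 f = f := by
  ext r
  simp

theorem scale_C (c : ℂ) (a : A) : scale c (C a) = C a := by
  ext r
  simp only [coeff_scale, coeff_C]
  split_ifs with h
  · simp [h]
  · simp

theorem scale_X (c : ℂ) : scale c (X : A⟦X⟧) = c • X := by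
  ext r
  simp only [coeff_scale, PowerSeries.coeff_smul, coeff_X]
  split_ifs with h
  · simp [h]
  · simp

theorem scaleArg_eq_scale (c : ℂ) (f : A⟦X⟧) : scaleArg c f = scale c⁻¹ f := by
  ext r
  simp [scaleArg]

/-- A series in the first variable. -/
def inner : A⟦X⟧ →+* A⟦X⟧⟦X⟧ := C

/-- A series in the second variable. -/
def outer : A⟦X⟧ →+* A⟦X⟧⟦X⟧ := PowerSeries.map C

/-- The first variable. -/
def varX : A⟦X⟧⟦X⟧ := C X

/-- The second variable. -/
def varY : A⟦X⟧⟦X⟧ := X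

theorem coeff_inner_mul_outer (f g : A⟦X⟧) (i j : ℕ) :
    coeff i (coeff j (inner f * outer g)) = coeff i f * coeff j g := by
  simp [inner, outer]

theorem coeff_outer_mul_inner (f g : A⟦X⟧) (i j : ℕ) :
    coeff i (coeff j (outer g * inner f)) = coeff j g * coeff i f := by
  simp [inner, outer]

theorem varX_comm (z : A⟦X⟧⟦X⟧) : Commute varX z := by
  rw [Commute, SemiconjBy]
  ext j : 1
  rw [varX, coeff_C_mul, coeff_mul_C, X_mul]

theorem varY_comm (z : A⟦X⟧⟦X⟧) : Commute varY z := (commute_X z).symm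

theorem coeff_varX_mul_zero (z : A⟦X⟧⟦X⟧) (j : ℕ) : coeff 0 (coeff j (varX * z)) = 0 := by
  rw [varX, coeff_C_mul, coeff_zero_X_mul]

theorem coeff_varX_mul_succ (z : A⟦X⟧⟦X⟧) (i j : ℕ) :
    coeff (i + 1) (coeff j (varX * z)) = coeff i (coeff j z) := by
  rw [varX, coeff_C_mul, coeff_succ_X_mul]

theorem coeff_varY_mul_zero (z : A⟦X⟧⟦X⟧) (i : ℕ) : coeff i (coeff 0 (varY * z)) = 0 := by
  rw [varY, coeff_zero_X_mul, map_zero]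

theorem coeff_varY_mul_succ (z : A⟦X⟧⟦X⟧) (i j : ℕ) :
    coeff i (coeff (j + 1) (varY * z)) = coeff i (coeff j z) := by
  rw [varY, coeff_succ_X_mul]

/-- Induction on the degree i in the first variable: the coefficient of xⁱy^{j+1} is a·z_{i,j} +
b·z_{i−1,j+1}, and the second term is already zero. -/
theorem linear_reg {a b : ℂ} (ha : a ≠ 0) {z : A⟦X⟧⟦X⟧} (h : (a • varY + b • varX) * z = 0) :
    z = 0 := by
  have key : ∀ i j, coeff i (coeff j z) = 0 := by
    intro i
    induction i with
    | zero =>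
      intro j
      have e := congrArg (fun w => coeff 0 (coeff (j + 1) w)) h
      simp only [add_mul, smul_mul_assoc, map_add, PowerSeries.coeff_smul, coeff_varY_mul_succ,
        coeff_varX_mul_zero, smul_zero, add_zero, map_zero] at e
      exact (smul_eq_zero_iff_right ha).1 e
    | succ i ih =>
      intro j
      have e := congrArg (fun w => coeff (i + 1) (coeff (j + 1) w)) h
      simp only [add_mul, smul_mul_assoc, map_add, PowerSeries.coeff_smul, coeff_varY_mul_succ,
        coeff_varX_mul_succ, ih, smul_zero, add_zero, map_zero] at e
      exact (smul_eq_zero_iff_right ha).1 e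
  ext j i
  simp [key]

theorem quadratic_reg {a b : ℂ} (hb : b ≠ 0) {z : A⟦X⟧⟦X⟧}
    (h : (a • (varX * varY) + b • 1) * z = 0) : z = 0 := by
  have key : ∀ i j, coeff i (coeff j z) = 0 := by
    intro i
    induction i with
    | zero =>
      intro j
      have e := congrArg (fun w => coeff 0 (coeff j w)) h
      simp only [add_mul, smul_mul_assoc, map_add, PowerSeries.coeff_smul, mul_assoc, one_mul,
        coeff_varX_mul_zero, smul_zero, zero_add, map_zero] at e
      exact (smul_eq_zero_iff_right hb).1 e
    | succ i ih =>
      intro j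
      have e := congrArg (fun w => coeff (i + 1) (coeff j w)) h
      have e' : coeff i (coeff j (varY * z)) = 0 := by
        cases j with
        | zero => rw [coeff_varY_mul_zero]
        | succ j => rw [coeff_varY_mul_succ, ih]
      simp only [add_mul, smul_mul_assoc, map_add, PowerSeries.coeff_smul, mul_assoc, one_mul,
        coeff_varX_mul_succ, e', smul_zero, zero_add, map_zero] at e
      exact (smul_eq_zero_iff_right hb).1 e
  ext j i
  simp [key]

/-- For T̄(u), T̄(v) the variables are x = u and y = v, with parameters (x, y). For T(u), T(v) they
are x = u⁻¹ and y = v⁻¹; multiplying R(u,v) by xy gives the parameters (y, x), covered by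
`Spectral.symm`. -/
theorem spectral_linear {q : ℂ} (hq : q ≠ 0) : Spectral q (varX : A⟦X⟧⟦X⟧) varY where
  left_comm := varX_comm
  right_comm := varY_comm
  reg_sub z hz := linear_reg (a := -1) (b := 1) (by simp) (z := z) (by
    rw [← hz]; congr 1; simp [sub_eq_neg_add])
  reg_left z hz := linear_reg (a := -q) (b := q⁻¹) (by simpa) (z := z) (by
    rw [← hz]; congr 1; rw [neg_smul]; abel)
  reg_right z hz := linear_reg (a := q⁻¹) (b := -q) (by simpa) (z := z) (by
    rw [← hz]; congr 1; rw [neg_smul]; abel)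

/-- For T̄(u), T(v) the variables are x = u and y = v⁻¹; multiplying R(u,v) by y gives the
parameters (xy, 1). -/
theorem spectral_quadratic {q : ℂ} (hq : q ≠ 0) :
    Spectral q (varX * varY : A⟦X⟧⟦X⟧) 1 where
  left_comm z := (varX_comm z).mul_left (varY_comm z)
  right_comm := Commute.one_left
  reg_sub z hz := quadratic_reg (a := 1) (b := -1) (by simp) (z := z) (by
    rw [← hz]; congr 1; simp [sub_eq_add_neg])
  reg_left z hz := quadratic_reg (a := q⁻¹) (b := -q) (by simpa) (z := z) (by
    rw [← hz]; congr 1; rw [neg_smul]; abel)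
  reg_right z hz := quadratic_reg (a := -q) (b := q⁻¹) (by simpa) (z := z) (by
    rw [← hz]; congr 1; rw [neg_smul]; abel)

/-- Every coefficient of `f` commutes with every coefficient of `g`. -/
def CoeffCommute (f g : A⟦X⟧) : Prop := ∀ i j, Commute (coeff i f) (coeff j g)

/-- Commutation in independent variables is what exchange relations deliver, and it survives
rescaling either argument. -/
theorem coeffCommute_iff {f g : A⟦X⟧} : CoeffCommute f g ↔ Commute (inner f) (outer g) := by
  constructor
  · intro h
    rw [Commute, SemiconjBy]
    ext j i
    rw [coeff_inner_mul_outer, coeff_outer_mul_inner, (h i j).eq]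
  · intro h i j
    rw [Commute, SemiconjBy, ← coeff_inner_mul_outer, ← coeff_outer_mul_inner, h.eq]

theorem CoeffCommute.symm {f g : A⟦X⟧} (h : CoeffCommute f g) : CoeffCommute g f :=
  fun i j => (h j i).symm

theorem CoeffCommute.commute {f g : A⟦X⟧} (h : CoeffCommute f g) : Commute f g := by
  rw [Commute, SemiconjBy]
  ext r
  rw [coeff_mul, coeff_mul, ← Finset.Nat.sum_antidiagonal_swap]
  exact Finset.sum_congr rfl fun x _ => (h _ _).eq

theorem CoeffCommute.mul_left {f f' g : A⟦X⟧} (h : CoeffCommute f g) (h' : CoeffCommute f' g) :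
    CoeffCommute (f * f') g := by
  rw [coeffCommute_iff] at *
  rw [map_mul]
  exact h.mul_left h'

theorem CoeffCommute.sum_left {ι : Type*} {s : Finset ι} {f : ι → A⟦X⟧} {g : A⟦X⟧}
    (h : ∀ i ∈ s, CoeffCommute (f i) g) : CoeffCommute (∑ i ∈ s, f i) g := by
  simp only [coeffCommute_iff, map_sum] at *
  exact Commute.sum_left _ _ _ h

theorem CoeffCommute.smul_left {f g : A⟦X⟧} (h : CoeffCommute f g) (c : ℂ) :
    CoeffCommute (c • f) g := fun i j => by
  rw [PowerSeries.coeff_smul]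
  exact (h i j).smul_left c

theorem CoeffCommute.scale_left {f g : A⟦X⟧} (h : CoeffCommute f g) (c : ℂ) :
    CoeffCommute (scale c f) g := fun i j => by
  rw [coeff_scale]
  exact (h i j).smul_left _

theorem CoeffCommute.scale_right {f g : A⟦X⟧} (h : CoeffCommute f g) (c : ℂ) :
    CoeffCommute f (scale c g) := (h.symm.scale_left c).symm

theorem CoeffCommute.one_left (g : A⟦X⟧) : CoeffCommute 1 g := by
  rw [coeffCommute_iff, map_one]
  exact Commute.one_left _

theorem CoeffCommute.list_prod_left {l : List A⟦X⟧} {g : A⟦X⟧}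
    (h : ∀ f ∈ l, CoeffCommute f g) : CoeffCommute l.prod g := by
  induction l with
  | nil => exact CoeffCommute.one_left g
  | cons f l ih =>
    rw [List.prod_cons]
    exact (h f (by simp)).mul_left (ih fun f' hf' => h f' (by simp [hf']))

/-- Rescaling of both variables. -/
def scaleBoth (c d : ℂ) : A⟦X⟧⟦X⟧ →ₐ[ℂ] A⟦X⟧⟦X⟧ := (scale d).comp (mapAlgHom (scale c))

theorem coeff_scaleBoth (c d : ℂ) (F : A⟦X⟧⟦X⟧) (j : ℕ) :
    coeff j (scaleBoth c d F) = d ^ j • scale c (coeff j F) := by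
  rw [scaleBoth, AlgHom.comp_apply, coeff_scale]
  rfl

theorem scaleBoth_inner (c d : ℂ) (f : A⟦X⟧) : scaleBoth c d (inner f) = inner (scale c f) := by
  ext j : 1
  rw [coeff_scaleBoth, inner, coeff_C, coeff_C]
  split_ifs with h
  · simp [h]
  · simp

theorem scaleBoth_outer (c d : ℂ) (f : A⟦X⟧) : scaleBoth c d (outer f) = outer (scale d f) := by
  ext j : 1
  rw [coeff_scaleBoth, outer, coeff_map, coeff_map, scale_C, coeff_scale]
  ext i
  simp [coeff_C]

theorem scaleBoth_varX (c d : ℂ) : scaleBoth c d (varX : A⟦X⟧⟦X⟧) = c • varX := by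
  have h : (varX : A⟦X⟧⟦X⟧) = inner X := rfl
  rw [h, scaleBoth_inner, scale_X]
  ext j : 1
  simp only [inner, coeff_C, PowerSeries.coeff_smul]
  split_ifs <;> simp

theorem scaleBoth_varY (c d : ℂ) : scaleBoth c d (varY : A⟦X⟧⟦X⟧) = d • varY := by
  ext j : 1
  simp only [varY, coeff_scaleBoth, PowerSeries.coeff_smul, coeff_X]
  split_ifs with h
  · simp [h]
  · simp

/-- The specialization of the second variable to `p` times the first one. -/
def specialize (p : ℂ) : A⟦X⟧⟦X⟧ →ₗ[ℂ] A⟦X⟧ where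
  toFun F := PowerSeries.mk fun r =>
    ∑ x ∈ Finset.HasAntidiagonal.antidiagonal r, p ^ x.2 • coeff x.1 (coeff x.2 F)
  map_add' F G := by
    ext r
    simp [Finset.sum_add_distrib]
  map_smul' k F := by
    ext r
    simp only [PowerSeries.coeff_smul, coeff_mk, RingHom.id_apply, Finset.smul_sum]
    exact Finset.sum_congr rfl fun x _ => smul_comm _ _ _

theorem coeff_specialize (p : ℂ) (F : A⟦X⟧⟦X⟧) (r : ℕ) : coeff r (specialize p F) =
    ∑ x ∈ Finset.HasAntidiagonal.antidiagonal r, p ^ x.2 • coeff x.1 (coeff x.2 F) := by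
  simp [specialize]

theorem specialize_inner_mul_outer (p : ℂ) (f g : A⟦X⟧) :
    specialize p (inner f * outer g) = f * scale p g := by
  ext r
  simp only [coeff_specialize, coeff_inner_mul_outer]
  simp [coeff_mul]

theorem specialize_outer_mul_inner (p : ℂ) (f g : A⟦X⟧) :
    specialize p (outer g * inner f) = scale p g * f := by
  ext r
  rw [coeff_specialize, coeff_mul, ← Finset.Nat.sum_antidiagonal_swap]
  simp only [coeff_outer_mul_inner]
  simp

theorem specialize_varX_mul (p : ℂ) (F : A⟦X⟧⟦X⟧) :
    specialize p (varX * F) = X * specialize p F := by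
  ext r
  cases r with
  | zero =>
    rw [coeff_zero_X_mul]
    simp [coeff_specialize, coeff_varX_mul_zero, -coeff_zero_eq_constantCoeff]
  | succ r =>
    rw [coeff_succ_X_mul, coeff_specialize, coeff_specialize, Finset.Nat.sum_antidiagonal_succ]
    simp [coeff_varX_mul_zero, coeff_varX_mul_succ, -coeff_zero_eq_constantCoeff]

theorem specialize_varY_mul (p : ℂ) (F : A⟦X⟧⟦X⟧) :
    specialize p (varY * F) = p • (X * specialize p F) := by
  ext r
  rw [PowerSeries.coeff_smul]
  cases r with
  | zero =>
    rw [coeff_zero_X_mul]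
    simp [coeff_specialize, coeff_varY_mul_zero, -coeff_zero_eq_constantCoeff]
  | succ r =>
    rw [coeff_succ_X_mul, coeff_specialize, coeff_specialize, Finset.Nat.sum_antidiagonal_succ']
    simp [coeff_varY_mul_zero, coeff_varY_mul_succ, -coeff_zero_eq_constantCoeff, Finset.smul_sum,
      pow_succ', mul_smul]

/-- The consequences of the exchange relation at `v = q⁻²u`: columns may be exchanged in
quantum minors of order two. Here `X ↦ pX` is the substitution `u ↦ q⁻²u`. -/
structure ColAntisymm (q p : ℂ) {n : ℕ} (M : Matrix (Fin n) (Fin n) A⟦X⟧) : Prop where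
  same : ∀ a b c, a < b → M a c * scale p (M b c) = q⁻¹ • (M b c * scale p (M a c))
  exchange : ∀ a b c d, a < b → c < d →
    M a d * scale p (M b c) - q⁻¹ • (M b d * scale p (M a c)) =
      -q⁻¹ • (M a c * scale p (M b d) - q⁻¹ • (M b c * scale p (M a d)))

/-- The parameters `α`, `β` specialize to scalar multiples of `X` whose quotient is `q⁻²`. -/
def SpecializesTo (q p k : ℂ) (α β : A⟦X⟧⟦X⟧) : Prop :=
  k ≠ 0 ∧ (∀ F, specialize p (α * F) = k • (X * specialize p F)) ∧
    ∀ F, specialize p (β * F) = (k * (q⁻¹ * q⁻¹)) • (X * specialize p F)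

theorem specializesTo_varY_varX {q : ℂ} (hq : q ≠ 0) :
    SpecializesTo q (q ^ 2) (q ^ 2) (varY : A⟦X⟧⟦X⟧) varX :=
  ⟨pow_ne_zero 2 hq, specialize_varY_mul _, fun F => by
    rw [specialize_varX_mul, show q ^ 2 * (q⁻¹ * q⁻¹) = 1 by field_simp, one_smul]⟩

theorem specializesTo_varX_varY {q : ℂ} :
    SpecializesTo q ((q ^ 2)⁻¹) 1 (varX : A⟦X⟧⟦X⟧) varY :=
  ⟨one_ne_zero, fun F => by rw [specialize_varX_mul, one_smul], fun F => by
    rw [specialize_varY_mul, one_mul, ← mul_inv, ← sq]⟩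

/-- At v = q⁻²u the factor q⁻¹u − qv vanishes, so R loses rank: the right side is zero for c = d,
and the right sides for (c,d) and (d,c) are proportional. -/
theorem RTT.colAntisymm {q p k : ℂ} (hq : q ≠ 0) (hq2 : q ^ 2 ≠ 1) {α β : A⟦X⟧⟦X⟧}
    (hs : Spectral q α β) (hp : SpecializesTo q p k α β) {n : ℕ}
    {M : Matrix (Fin n) (Fin n) A⟦X⟧} (h : RTT q α β (M.map inner) (M.map outer)) :
    ColAntisymm q p M := by
  obtain ⟨hk, hα, hβ⟩ := hp
  -- The specialized value of α − β, up to the factor X; it has to be cancelled at the end.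
  have hne : k * (1 - q⁻¹ * q⁻¹) ≠ 0 := by
    refine mul_ne_zero hk fun h0 => hq2 ?_
    field_simp at h0
    linear_combination h0
  have h' : ∀ a b c d, specialize p (rDiag q α β a b * (inner (M a c) * outer (M b d)) +
      rOff q α β a b * (inner (M b c) * outer (M a d))) =
      specialize p (rDiag q α β c d * (outer (M b d) * inner (M a c)) +
      rOff q α β d c * (outer (M b c) * inner (M a d))) := fun a b c d => by
    -- `specialize` is not multiplicative; it handles α and β only as left factors, so the central
    -- entries of R are moved there.
    rw [(hs.rDiag_comm c d _).eq, (hs.rOff_comm d c _).eq]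
    exact congrArg _ (h a b c d)
  constructor
  · intro a b c hab
    have e := h' a b c c
    simp only [rDiag, rOff, hab.ne, if_false, if_true, hab.not_gt, sub_mul, smul_mul_assoc,
      zero_mul, add_zero, map_add, map_sub, map_smul, hα, hβ, specialize_inner_mul_outer,
      specialize_outer_mul_inner] at e
    apply X_mul_cancel
    apply smul_right_injective _ hne
    simp only [mul_smul_comm]
    linear_combination (norm := (match_scalars <;> field_simp <;> ring)) e
  · intro a b c d hab hcd
    have e := h' a b c d
    have e' := h' a b d c
    simp only [rDiag, rOff, hab.ne, if_false, if_true, hab.not_gt, sub_mul, smul_mul_assoc,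
      map_add, map_sub, map_smul, hα, hβ, specialize_inner_mul_outer,
      specialize_outer_mul_inner, hcd, hcd.not_gt, hcd.ne, hcd.ne'] at e e'
    apply X_mul_cancel
    apply smul_right_injective _ (mul_ne_zero hq hne)
    simp only [mul_smul_comm, mul_sub]
    -- For c < d the right side of `e` is −q times that of `e'`, so this combination retains only
    -- the left sides.
    linear_combination (norm := (match_scalars <;> field_simp <;> ring)) e + q • e'

end TwoVariables

/-! ### Inversion numbers -/

section Permutations

/-- The swap of adjacent positions carries the inversions of σ bijectively to those of the product,
except for the new inversion (i, j): this is the only pair whose order it changes. -/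
theorem permLength_mul_swap {r : ℕ} (σ : Equiv.Perm (Fin r)) {i j : Fin r}
    (hij : (j : ℕ) = i + 1) (h : σ i < σ j) :
    permLength (σ * Equiv.swap i j) = permLength σ + 1 := by
  have hlt : i < j := by rw [Fin.lt_def]; omega
  have hne : i ≠ j := hlt.ne
  have key : (Finset.univ.filter fun p : Fin r × Fin r =>
      p.1 < p.2 ∧ (σ * Equiv.swap i j) p.2 < (σ * Equiv.swap i j) p.1) =
      insert (i, j) ((Finset.univ.filter fun p : Fin r × Fin r => p.1 < p.2 ∧ σ p.2 < σ p.1).map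
        ((Equiv.swap i j).prodCongr (Equiv.swap i j)).toEmbedding) := by
    ext ⟨x, y⟩
    rw [Finset.mem_filter]
    simp only [Finset.mem_filter, Finset.mem_univ, true_and, Finset.mem_insert, Finset.mem_map_equiv,
      Equiv.prodCongr_symm, Equiv.prodCongr_apply, Prod.map, Equiv.symm_swap, Prod.mk.injEq]
    simp only [Equiv.Perm.mul_apply]
    by_cases hxy : x = i ∧ y = j
    · obtain ⟨rfl, rfl⟩ := hxy
      simp [hlt, h]
    · by_cases hyx : x = j ∧ y = i
      · obtain ⟨rfl, rfl⟩ := hyx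
        simp [hlt.not_gt, h.not_gt, hne, hne.symm]
      · have hiff : x < y ↔ Equiv.swap i j x < Equiv.swap i j y := by
          simp only [Equiv.swap_apply_def]
          simp only [Fin.lt_def, Fin.ext_iff] at *
          split_ifs <;> omega
        rw [hiff]
        simp [hxy]
  rw [permLength, key, Finset.card_insert_of_notMem, Finset.card_map, permLength]
  simp [Finset.mem_map_equiv, hlt.not_gt]

/-- The permutation sending the last element to `k` and the others as `τ`, followed by the
increasing bijection onto the complement of `k`. -/
def snocPerm {r : ℕ} (k : Fin (r + 1)) (τ : Equiv.Perm (Fin r)) : Equiv.Perm (Fin (r + 1)) :=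
  Equiv.ofBijective (Fin.snoc (α := fun _ => Fin (r + 1)) (fun x => k.succAbove (τ x)) k) <| by
    rw [← Finite.injective_iff_bijective]
    intro x y
    refine Fin.lastCases ?_ (fun x => ?_) x <;> refine Fin.lastCases ?_ (fun y => ?_) y
    · simp
    · simp [(Fin.succAbove_ne k _).symm]
    · simp [Fin.succAbove_ne k _]
    · simp

@[simp]
theorem snocPerm_last {r : ℕ} (k : Fin (r + 1)) (τ : Equiv.Perm (Fin r)) :
    snocPerm k τ (Fin.last r) = k := by
  simp [snocPerm]

@[simp]
theorem snocPerm_castSucc {r : ℕ} (k : Fin (r + 1)) (τ : Equiv.Perm (Fin r)) (x : Fin r) :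
    snocPerm k τ x.castSucc = k.succAbove (τ x) := by
  simp [snocPerm]

theorem snocPerm_bijective (r : ℕ) :
    Function.Bijective fun x : Fin (r + 1) × Equiv.Perm (Fin r) => snocPerm x.1 x.2 := by
  rw [Fintype.bijective_iff_injective_and_card]
  constructor
  · rintro ⟨k, τ⟩ ⟨k', τ'⟩ h
    have hk : k = k' := by simpa using congrArg (fun σ => σ (Fin.last r)) h
    subst hk
    have : τ = τ' := by
      ext x : 1
      simpa using congrArg (fun σ => σ x.castSucc) h
    rw [this]
  · simp [Fintype.card_perm, Nat.factorial_succ]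

theorem permLength_eq_sum {r : ℕ} (σ : Equiv.Perm (Fin r)) :
    permLength σ = ∑ x, ∑ y, if x < y ∧ σ y < σ x then 1 else 0 := by
  rw [permLength, Finset.card_filter, Fintype.sum_prod_type]

/-- The value k in the last position forms an inversion with each of the r − k larger values. -/
theorem permLength_snocPerm {r : ℕ} (k : Fin (r + 1)) (τ : Equiv.Perm (Fin r)) :
    permLength (snocPerm k τ) = permLength τ + (r - k) := by
  have h1 : ∑ x : Fin r, (if k < k.succAbove (τ x) then 1 else 0) = r - (k : ℕ) := by
    rw [Equiv.sum_comp τ fun t => if k < k.succAbove t then 1 else 0]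
    have := Fin.sum_univ_succAbove (fun z => if k < z then 1 else 0) k
    simp only [lt_irrefl, if_false, zero_add] at this
    rw [← this, ← Finset.card_filter]
    have h2 : (Finset.univ.filter fun z => k < z) = Finset.Ioi k := by ext; simp
    rw [h2, Fin.card_Ioi]
    omega
  rw [permLength_eq_sum, permLength_eq_sum, ← h1, Fin.sum_univ_castSucc]
  simp only [Fin.sum_univ_castSucc (n := r), snocPerm_last, snocPerm_castSucc,
    Fin.castSucc_lt_castSucc_iff, (Fin.strictMono_succAbove k).lt_iff_lt, Fin.castSucc_lt_last,
    true_and, lt_irrefl, false_and, if_false, add_zero, Finset.sum_add_distrib,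
    (Fin.castSucc_lt_last _).not_gt, Finset.sum_const_zero]

end Permutations

/-- The outer factors are chosen before g, so one pair serves all products differing only at two
adjacent places. -/
theorem exists_ofFn_prod_split {R : Type*} [Monoid R] {r : ℕ} (f : Fin r → R) {i j : Fin r}
    (hij : (j : ℕ) = i + 1) : ∃ P Q : R, ∀ g : Fin r → R, (∀ k, k ≠ i → k ≠ j → g k = f k) →
      (List.ofFn g).prod = P * (g i * g j) * Q := by
  refine ⟨((List.ofFn f).take i).prod, ((List.ofFn f).drop (i + 2)).prod, fun g hg => ?_⟩
  have h1 : (List.ofFn g).take i = (List.ofFn f).take i := by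
    apply List.ext_getElem (by simp)
    intro n hn _
    simp only [List.length_take, List.length_ofFn, lt_min_iff] at hn
    simp only [List.getElem_take, List.getElem_ofFn]
    exact hg _ (fun h => by simp [← h] at hn) (fun h => by
      have := congrArg Fin.val h
      simp only at this
      omega)
  have h2 : (List.ofFn g).drop (i + 2) = (List.ofFn f).drop (i + 2) := by
    apply List.ext_getElem (by simp)
    intro n hn _
    simp only [List.getElem_drop, List.getElem_ofFn]
    exact hg _ (fun h => by
      have := congrArg Fin.val h
      simp only at this
      omega) (fun h => by
      have := congrArg Fin.val h
      simp only at this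
      omega)
  have hj : (i : ℕ) + 1 < r := by have := j.isLt; omega
  have hj' : (⟨(i : ℕ) + 1, hj⟩ : Fin r) = j := Fin.ext hij.symm
  rw [← h1, ← h2]
  conv_lhs => rw [← List.take_append_drop i (List.ofFn g)]
  rw [List.drop_eq_getElem_cons (by simp), List.drop_eq_getElem_cons (by simpa using hj)]
  simp [hj', mul_assoc]

/-! ### Quantum minors: antisymmetry, expansion, factorization -/

section Minors

variable {A : Type*} [Ring A] [Algebra ℂ A]

/-- The summand of a quantum minor corresponding to a permutation; `X ↦ pX` is the shift of the
spectral parameter between two consecutive factors. -/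
def minorTerm (q p : ℂ) {n r : ℕ} (M : Matrix (Fin n) (Fin n) A⟦X⟧) (a b : Fin r → Fin n)
    (σ : Equiv.Perm (Fin r)) : A⟦X⟧ :=
  (-q) ^ (-(permLength σ : ℤ)) •
    (List.ofFn fun k : Fin r => scale (p ^ (k : ℕ)) (M (a (σ k)) (b k))).prod

/-- The quantum minor with the shift of the spectral parameter given by `X ↦ pX`. -/
def minor (q p : ℂ) {n r : ℕ} (M : Matrix (Fin n) (Fin n) A⟦X⟧) (a b : Fin r → Fin n) : A⟦X⟧ :=
  ∑ σ : Equiv.Perm (Fin r), minorTerm q p M a b σ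

theorem qMinor_eq_minor (q : ℂ) {n r : ℕ} (M : Matrix (Fin n) (Fin n) A⟦X⟧)
    (a b : Fin r → Fin n) : qMinor q M a b = minor q (q ^ 2) M a b := by
  unfold qMinor minor minorTerm
  refine Finset.sum_congr rfl fun σ _ => ?_
  congr 3
  funext k
  rw [scaleArg_eq_scale, ← zpow_neg, neg_mul, neg_neg, zpow_mul]
  norm_cast

theorem minor_submatrix (q p : ℂ) {n n' r : ℕ} (M : Matrix (Fin n) (Fin n) A⟦X⟧)
    (f : Fin n' → Fin n) (a b : Fin r → Fin n') :
    minor q p (M.submatrix f f) a b = minor q p M (f ∘ a) (f ∘ b) := rfl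

theorem minor_zero (q p : ℂ) {n : ℕ} (M : Matrix (Fin n) (Fin n) A⟦X⟧) (a b : Fin 0 → Fin n) :
    minor q p M a b = 1 := by
  simp [minor, minorTerm, permLength]

/-- Pair σ with σ·(i j); exactly one member of each pair satisfies σ i < σ j. -/
theorem sum_perm_eq_zero {r : ℕ} {G : Equiv.Perm (Fin r) → A⟦X⟧} {i j : Fin r} (hij : i ≠ j)
    (h : ∀ σ : Equiv.Perm (Fin r), σ i < σ j → G σ + G (σ * Equiv.swap i j) = 0) :
    ∑ σ, G σ = 0 := by
  refine Finset.sum_involution (fun σ _ => σ * Equiv.swap i j) ?_ ?_ ?_ ?_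
  · intro σ _
    rcases lt_or_gt_of_ne (σ.injective.ne hij) with hlt | hlt
    · exact h σ hlt
    · have := h (σ * Equiv.swap i j) (by simpa using hlt)
      rw [mul_assoc, Equiv.swap_mul_self, mul_one] at this
      rw [add_comm, this]
  · intro σ _ _ h0
    have := congrArg (fun τ => τ i) h0
    simp only [Equiv.Perm.mul_apply, Equiv.swap_apply_left] at this
    exact hij (σ.injective this).symm
  · intro σ _
    exact Finset.mem_univ _
  · intro σ _
    simp [mul_assoc]

theorem neg_zpow_permLength_mul_swap {q : ℂ} (hq : q ≠ 0) {r : ℕ} (σ : Equiv.Perm (Fin r))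
    {i j : Fin r} (hij : (j : ℕ) = i + 1) (h : σ i < σ j) :
    (-q) ^ (-(permLength (σ * Equiv.swap i j) : ℤ)) =
      (-q) ^ (-(permLength σ : ℤ)) * -q⁻¹ := by
  rw [permLength_mul_swap σ hij h]
  push_cast
  rw [neg_add, zpow_add₀ (neg_ne_zero.2 hq), zpow_neg_one, inv_neg]

theorem minor_eq_zero_of_adjacent {q p : ℂ} (hq : q ≠ 0) {n r : ℕ}
    {M : Matrix (Fin n) (Fin n) A⟦X⟧} (hM : ColAntisymm q p M) {a b : Fin r → Fin n}
    (ha : StrictMono a) {i j : Fin r} (hij : (j : ℕ) = i + 1) (hb : b i = b j) :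
    minor q p M a b = 0 := by
  have hne : i ≠ j := fun h => by simp [h] at hij
  refine sum_perm_eq_zero hne fun σ hσ => ?_
  obtain ⟨P, Q, hPQ⟩ := exists_ofFn_prod_split
    (fun k : Fin r => scale (p ^ (k : ℕ)) (M (a (σ k)) (b k))) hij
  unfold minorTerm
  rw [hPQ _ fun _ _ _ => rfl, hPQ (fun k => scale (p ^ (k : ℕ)) (M (a ((σ * Equiv.swap i j) k)) (b k)))
    fun k hk hk' => by simp [Equiv.swap_apply_of_ne_of_ne hk hk'],
    neg_zpow_permLength_mul_swap hq σ hij hσ]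
  have := hM.same (a (σ i)) (a (σ j)) (b i) (ha hσ)
  simp only [Equiv.Perm.mul_apply, Equiv.swap_apply_left, Equiv.swap_apply_right, hij, ← hb, pow_succ,
    ← scale_scale, ← map_mul, this]
  simp only [map_smul, mul_smul_comm, smul_mul_assoc, smul_smul, ← add_smul]
  simp

/-- The terms of σ and σ·(i j) share all but two neighbouring factors, which combine to a quantum
minor of order two. As the rows increase, `ColAntisymm.exchange` applies to it. -/
theorem minor_comp_swap {q p : ℂ} (hq : q ≠ 0) {n r : ℕ}
    {M : Matrix (Fin n) (Fin n) A⟦X⟧} (hM : ColAntisymm q p M) {a b : Fin r → Fin n}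
    (ha : StrictMono a) {i j : Fin r} (hij : (j : ℕ) = i + 1) (hb : b i < b j) :
    minor q p M a (b ∘ Equiv.swap i j) = -q⁻¹ • minor q p M a b := by
  have hne : i ≠ j := fun h => by simp [h] at hij
  rw [← sub_eq_zero]
  unfold minor
  rw [Finset.smul_sum, ← Finset.sum_sub_distrib]
  refine sum_perm_eq_zero hne fun σ hσ => ?_
  obtain ⟨P, Q, hPQ⟩ := exists_ofFn_prod_split
    (fun k : Fin r => scale (p ^ (k : ℕ)) (M (a (σ k)) (b k))) hij
  unfold minorTerm
  rw [hPQ (fun k => scale (p ^ (k : ℕ)) (M (a (σ k)) ((b ∘ Equiv.swap i j) k)))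
      fun k hk hk' => by simp [Equiv.swap_apply_of_ne_of_ne hk hk'],
    hPQ _ fun _ _ _ => rfl,
    hPQ (fun k => scale (p ^ (k : ℕ)) (M (a ((σ * Equiv.swap i j) k)) ((b ∘ Equiv.swap i j) k)))
      fun k hk hk' => by simp [Equiv.swap_apply_of_ne_of_ne hk hk'],
    hPQ (fun k => scale (p ^ (k : ℕ)) (M (a ((σ * Equiv.swap i j) k)) (b k)))
      fun k hk hk' => by simp [Equiv.swap_apply_of_ne_of_ne hk hk'],
    neg_zpow_permLength_mul_swap hq σ hij hσ]
  have := hM.exchange (a (σ i)) (a (σ j)) (b i) (b j) (ha hσ) hb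
  simp only [Function.comp_apply, Equiv.Perm.mul_apply, Equiv.swap_apply_left,
    Equiv.swap_apply_right, hij, pow_succ, ← scale_scale, ← map_mul]
  generalize (-q) ^ (-(permLength σ : ℤ)) = c
  have h2 := congrArg (fun z => c • (P * scale (p ^ (i : ℕ)) z * Q)) this
  simp only [map_sub, map_smul, mul_sub, sub_mul, mul_smul_comm, smul_mul_assoc] at h2
  linear_combination (norm := (match_scalars <;> field_simp <;> ring)) h2

/-- Induction on the distance of the equal columns: column j moves one place towards i, which
changes the minor by a nonzero factor, unless its neighbour equals it and the minor vanishes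
already. -/
theorem minor_eq_zero {q p : ℂ} (hq : q ≠ 0) {n r : ℕ}
    {M : Matrix (Fin n) (Fin n) A⟦X⟧} (hM : ColAntisymm q p M) {a : Fin r → Fin n}
    (ha : StrictMono a) (d : ℕ) {i j : Fin r} (hij : (j : ℕ) = i + 1 + d) {b : Fin r → Fin n}
    (hb : b i = b j) : minor q p M a b = 0 := by
  induction d generalizing j b with
  | zero => exact minor_eq_zero_of_adjacent hq hM ha hij hb
  | succ d ih =>
    have hk : (j : ℕ) - 1 < r := by have := j.isLt; omega
    set k : Fin r := ⟨(j : ℕ) - 1, hk⟩ with hkdef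
    have hjk : (j : ℕ) = k + 1 := by simp only [hkdef]; omega
    have hki : (k : ℕ) = i + 1 + d := by simp only [hkdef]; omega
    have hik : i ≠ k := fun h => by rw [h] at hki; omega
    have hijne : i ≠ j := fun h => by rw [h] at hij; omega
    have h0 : minor q p M a (b ∘ Equiv.swap k j) = 0 := ih hki (by
      simp [Equiv.swap_apply_of_ne_of_ne hik hijne, hb])
    rcases lt_trichotomy (b k) (b j) with h | h | h
    · rw [minor_comp_swap hq hM ha hjk h] at h0
      exact (smul_eq_zero_iff_right (by simpa using hq)).1 h0
    · exact minor_eq_zero_of_adjacent hq hM ha hjk h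
    · have h1 := minor_comp_swap hq hM ha (b := b ∘ Equiv.swap k j) hjk (by simpa using h)
      rw [h0, smul_zero, Function.comp_assoc] at h1
      simpa [← Equiv.coe_trans] using h1

/-- Expansion of a quantum minor along its last column. -/
theorem minor_succ {q : ℂ} (hq : q ≠ 0) (p : ℂ) {n r : ℕ} (M : Matrix (Fin n) (Fin n) A⟦X⟧)
    (a b : Fin (r + 1) → Fin n) :
    minor q p M a b = ∑ k : Fin (r + 1), (-q) ^ (-((r - k : ℕ) : ℤ)) •
      (minor q p M (a ∘ k.succAbove) (b ∘ Fin.castSucc) *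
        scale (p ^ r) (M (a k) (b (Fin.last r)))) := by
  rw [minor, ← (Equiv.ofBijective _ (snocPerm_bijective r)).sum_comp, Fintype.sum_prod_type]
  refine Finset.sum_congr rfl fun k _ => ?_
  rw [minor, Finset.sum_mul, Finset.smul_sum]
  refine Finset.sum_congr rfl fun τ _ => ?_
  simp only [Equiv.ofBijective_apply, minorTerm, permLength_snocPerm, List.ofFn_succ',
    List.concat_eq_append, List.prod_append, List.prod_singleton, snocPerm_last, snocPerm_castSucc,
    Fin.val_last, Fin.val_castSucc, Function.comp_apply, smul_mul_assoc, smul_smul]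
  congr 1
  rw [Nat.cast_add, neg_add, zpow_add₀ (neg_ne_zero.2 hq), mul_comm]

/-- Moving the first column, assumed to be the smallest, to position `k`. -/
theorem minor_insertNth {q p : ℂ} (hq : q ≠ 0) {n r : ℕ}
    {M : Matrix (Fin n) (Fin n) A⟦X⟧} (hM : ColAntisymm q p M) {a : Fin (r + 1) → Fin n}
    (ha : StrictMono a) {x : Fin n} {b : Fin r → Fin n} (hb : ∀ k, x < b k) (k : Fin (r + 1)) :
    minor q p M a (Fin.insertNth (α := fun _ => Fin n) k x b) =
      (-q⁻¹) ^ (k : ℕ) • minor q p M a (Fin.cons x b) := by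
  induction k using Fin.induction with
  | zero => simp
  | succ k ih =>
    have hsucc : Fin.insertNth (α := fun _ => Fin n) k.castSucc x b k.succ = b k := by
      conv_lhs => rw [← Fin.succAbove_castSucc_self k]
      rw [Fin.insertNth_apply_succAbove]
    have hcomp : Fin.insertNth (α := fun _ => Fin n) k.succ x b =
        Fin.insertNth (α := fun _ => Fin n) k.castSucc x b ∘ Equiv.swap k.castSucc k.succ := by
      rw [Fin.insertNth_eq_iff]
      refine ⟨by simp, ?_⟩
      funext y
      rw [Fin.removeNth, Function.comp_apply]
      rcases lt_trichotomy y k with h | rfl | h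
      · rw [Fin.succAbove_of_castSucc_lt _ _ (by
            simp only [Fin.lt_def, Fin.val_castSucc, Fin.val_succ] at *; omega),
          Equiv.swap_apply_of_ne_of_ne (by simpa using h.ne) (by
            simp only [ne_eq, Fin.ext_iff, Fin.val_castSucc, Fin.val_succ]; omega),
          ← Fin.succAbove_of_castSucc_lt k.castSucc y (by simpa using h),
          Fin.insertNth_apply_succAbove]
      · rw [Fin.succAbove_succ_self, Equiv.swap_apply_left, hsucc]
      · rw [Fin.succAbove_of_le_castSucc _ _ (by
            simp only [Fin.le_def, Fin.lt_def, Fin.val_castSucc, Fin.val_succ] at *; omega),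
          Equiv.swap_apply_of_ne_of_ne (by
            simp only [ne_eq, Fin.ext_iff, Fin.lt_def, Fin.val_castSucc, Fin.val_succ] at *; omega)
            (by simpa using h.ne'),
          ← Fin.succAbove_of_le_castSucc k.castSucc y (by simpa using h.le),
          Fin.insertNth_apply_succAbove]
    rw [hcomp, minor_comp_swap hq hM ha (by simp) (by
      rw [hsucc, Fin.insertNth_apply_same]; exact hb k), ih, smul_smul]
    simp [pow_succ']

/-- Factorization of a quantum minor through a quasideterminant (a Schur complement). -/
theorem minor_cons {q p : ℂ} (hq : q ≠ 0) {n s : ℕ}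
    {M : Matrix (Fin n) (Fin n) A⟦X⟧} (hM : ColAntisymm q p M) {Q : Fin s → Fin n}
    (hQ : StrictMono Q) {V : Matrix (Fin s) (Fin s) A⟦X⟧} (hV : M.submatrix Q Q * V = 1)
    {i j : Fin n} (hi : ∀ k, i < Q k) (hj : ∀ k, j < Q k) :
    minor q p M (Fin.cons i Q) (Fin.cons j Q) =
      minor q p M Q Q * scale (p ^ s) (M i j - ∑ k, ∑ l, M i (Q l) * V l k * M (Q k) j) := by
  have ha : StrictMono (Fin.cons i Q : Fin (s + 1) → Fin n) := by
    rw [Fin.strictMono_iff_lt_succ]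
    intro k
    cases s with
    | zero => exact k.elim0
    | succ s =>
      refine Fin.cases ?_ (fun k => ?_) k
      · simpa using hi 0
      · rw [Fin.castSucc_succ, Fin.cons_succ, Fin.cons_succ]
        exact hQ k.castSucc_lt_succ
  set c₀ : ℂ := (-q⁻¹) ^ s with hc₀
  have hc₀' : c₀ ≠ 0 := pow_ne_zero _ (by simpa using hq)
  set d := minor q p M Q Q with hd
  -- The signed cofactor of row `Q k` in the expansion along the last column; that row stands in
  -- position k + 1, below row i.
  set m : Fin s → A⟦X⟧ := fun k => (-q) ^ (-((s - (k + 1) : ℕ) : ℤ)) •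
    minor q p M (Fin.cons i Q ∘ k.succ.succAbove) Q with hm
  have expand : ∀ c, minor q p M (Fin.cons i Q) (Fin.snoc (α := fun _ => Fin n) Q c) =
      c₀ • (d * scale (p ^ s) (M i c)) + ∑ k, m k * scale (p ^ s) (M (Q k) c) := by
    intro c
    have hinit : (Fin.snoc (α := fun _ => Fin n) Q c) ∘ Fin.castSucc = Q := by
      funext; simp
    rw [minor_succ hq, Fin.sum_univ_succ, hinit]
    congr 1
    · have hc : (-q) ^ (-((s - ((0 : Fin (s + 1)) : ℕ) : ℕ) : ℤ)) = c₀ := by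
        rw [hc₀, ← inv_neg, inv_pow]
        simp
      have hsucc : (Fin.cons i Q : Fin (s + 1) → Fin n) ∘ Fin.succAbove 0 = Q := by
        funext; simp
      rw [hc, hsucc, Fin.cons_zero, Fin.snoc_last]
    · refine Finset.sum_congr rfl fun k _ => ?_
      simp [hm]
  -- With c = `Q l` a column is repeated, so the expansion vanishes: a linear system for the
  -- cofactors.
  have hzero : ∀ l, ∑ k, m k * scale (p ^ s) (M (Q k) (Q l)) =
      -(c₀ • (d * scale (p ^ s) (M i (Q l)))) := by
    intro l
    rw [eq_neg_iff_add_eq_zero, add_comm, ← expand]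
    exact minor_eq_zero hq hM ha (s - (l + 1)) (i := l.castSucc) (j := Fin.last s)
      (by simp only [Fin.val_last, Fin.val_castSucc]; omega) (by simp)
  -- The unknowns stand on the left, so the system is solved by the right inverse V.
  have hsolve : ∀ k, m k = -(c₀ • (d * scale (p ^ s) (∑ l, M i (Q l) * V l k))) := by
    intro k
    have h1 : ∀ k', ∑ l, scale (p ^ s) (M (Q k') (Q l)) * scale (p ^ s) (V l k) =
        if k' = k then 1 else 0 := by
      intro k'
      simp only [← map_mul, ← map_sum]
      have := congrFun (congrFun hV k') k
      rw [Matrix.mul_apply, Matrix.one_apply] at this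
      simp only [Matrix.submatrix_apply] at this
      rw [this]
      split_ifs <;> simp
    calc m k = ∑ k', m k' * ∑ l, scale (p ^ s) (M (Q k') (Q l)) * scale (p ^ s) (V l k) := by
          simp [h1]
      _ = ∑ l, (∑ k', m k' * scale (p ^ s) (M (Q k') (Q l))) * scale (p ^ s) (V l k) := by
          simp only [Finset.mul_sum, Finset.sum_mul, mul_assoc]
          exact Finset.sum_comm
      _ = _ := by
          simp only [hzero, map_sum, map_mul, Finset.mul_sum, Finset.smul_sum, neg_mul,
            smul_mul_assoc, mul_assoc, Finset.sum_neg_distrib]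
  -- Moving column j past the s larger columns costs c₀, the same constant that row i carries in the
  -- expansion, so it cancels.
  have hlast : minor q p M (Fin.cons i Q) (Fin.snoc (α := fun _ => Fin n) Q j) =
      c₀ • minor q p M (Fin.cons i Q) (Fin.cons j Q) := by
    have := minor_insertNth hq hM ha (b := Q) hj (Fin.last s)
    rwa [Fin.insertNth_last'] at this
  rw [expand] at hlast
  apply smul_right_injective _ hc₀'
  simp only
  rw [← hlast]
  simp only [hsolve, map_sub, map_sum, map_mul, mul_sub, smul_sub, Finset.mul_sum,
    Finset.smul_sum, neg_mul, smul_mul_assoc, Finset.sum_mul, Finset.sum_neg_distrib, mul_assoc]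
  rw [← sub_eq_add_neg]

end Minors

/-! ### Schur complements over a noncommutative ring -/

section SchurComplement

variable {C : Type*} [Ring C]

/-- The Schur complement of the block of `M` with rows and columns `Q`, in the block with rows and
columns `P`. -/
def schur {n m s : ℕ} (M : Matrix (Fin n) (Fin n) C) (P : Fin m → Fin n) (Q : Fin s → Fin n) :
    Matrix (Fin m) (Fin m) C :=
  M.submatrix P P - M.submatrix P Q * Ring.inverse (M.submatrix Q Q) * M.submatrix Q P

theorem schur_apply {n m s : ℕ} (M : Matrix (Fin n) (Fin n) C) (P : Fin m → Fin n)
    (Q : Fin s → Fin n) (i j : Fin m) :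
    schur M P Q i j = M (P i) (P j) -
      ∑ k, ∑ l, M (P i) (Q l) * Ring.inverse (M.submatrix Q Q) l k * M (Q k) (P j) := by
  simp [schur, Matrix.mul_apply, Finset.sum_mul]

theorem submatrix_mul_of_bijective {n m s k l : ℕ} {P : Fin m → Fin n} {Q : Fin s → Fin n}
    (h : Function.Bijective (Sum.elim P Q)) (M N : Matrix (Fin n) (Fin n) C)
    (R : Fin k → Fin n) (S : Fin l → Fin n) :
    (M * N).submatrix R S = M.submatrix R P * N.submatrix P S +
      M.submatrix R Q * N.submatrix Q S := by
  ext i j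
  simp only [Matrix.submatrix_apply, Matrix.mul_apply, Matrix.add_apply]
  rw [← (Equiv.ofBijective _ h).sum_comp]
  simp

theorem one_submatrix_self {n m : ℕ} {P : Fin m → Fin n} (h : Function.Injective P) :
    (1 : Matrix (Fin n) (Fin n) C).submatrix P P = 1 := by
  ext i j
  simp [Matrix.one_apply, h.eq_iff]

theorem one_submatrix_disjoint {n m s : ℕ} {P : Fin m → Fin n} {Q : Fin s → Fin n}
    (h : ∀ i k, P i ≠ Q k) : (1 : Matrix (Fin n) (Fin n) C).submatrix P Q = 0 := by
  ext i j
  simp [h]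

/-- The QP-block of MU = 1 expresses U_QP through U_PP; substitution into the PP-block leaves the
Schur complement. -/
theorem schur_mul_submatrix {n m s : ℕ} {M U : Matrix (Fin n) (Fin n) C} {P : Fin m → Fin n}
    {Q : Fin s → Fin n} (h : Function.Bijective (Sum.elim P Q)) (hMU : M * U = 1)
    (hQ : IsUnit (M.submatrix Q Q)) : schur M P Q * U.submatrix P P = 1 := by
  have hP : Function.Injective P := fun x y e => Sum.inl_injective (h.1 (by simpa using e))
  have hne : ∀ k i, Q k ≠ P i := fun k i e => by
    have := @h.1 (Sum.inr k) (Sum.inl i) (by simpa using e)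
    simp at this
  have h1 := submatrix_mul_of_bijective h M U P P
  have h2 := submatrix_mul_of_bijective h M U Q P
  rw [hMU, one_submatrix_self hP] at h1
  rw [hMU, one_submatrix_disjoint hne] at h2
  have h3 : U.submatrix Q P =
      -(Ring.inverse (M.submatrix Q Q) * (M.submatrix Q P * U.submatrix P P)) := by
    rw [eq_neg_of_add_eq_zero_left h2.symm, Matrix.mul_neg, neg_neg, ← Matrix.mul_assoc,
      Ring.inverse_mul_cancel _ hQ, Matrix.one_mul]
  rw [schur, Matrix.sub_mul, h1, h3]
  simp only [Matrix.mul_neg, Matrix.mul_assoc, sub_eq_add_neg]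

theorem submatrix_mul_schur {n m s : ℕ} {M U : Matrix (Fin n) (Fin n) C} {P : Fin m → Fin n}
    {Q : Fin s → Fin n} (h : Function.Bijective (Sum.elim P Q)) (hMU : U * M = 1)
    (hQ : IsUnit (M.submatrix Q Q)) : U.submatrix P P * schur M P Q = 1 := by
  have hP : Function.Injective P := fun x y e => Sum.inl_injective (h.1 (by simpa using e))
  have hne : ∀ i k, P i ≠ Q k := fun i k e => by
    have := @h.1 (Sum.inr k) (Sum.inl i) (by simpa using e.symm)
    simp at this
  have h1 := submatrix_mul_of_bijective h U M P P
  have h2 := submatrix_mul_of_bijective h U M P Q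
  rw [hMU, one_submatrix_self hP] at h1
  rw [hMU, one_submatrix_disjoint hne] at h2
  have h3 : U.submatrix P Q =
      -(U.submatrix P P * M.submatrix P Q * Ring.inverse (M.submatrix Q Q)) := by
    rw [eq_neg_of_add_eq_zero_left h2.symm, Matrix.neg_mul, neg_neg, Matrix.mul_assoc,
      Ring.mul_inverse_cancel _ hQ, Matrix.mul_one]
  rw [schur, Matrix.mul_sub, h1, h3]
  simp only [Matrix.neg_mul, Matrix.mul_assoc, sub_eq_add_neg]

theorem isUnit_of_isUnit_schur {n m s : ℕ} {M : Matrix (Fin n) (Fin n) C} {P : Fin m → Fin n}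
    {Q : Fin s → Fin n} (h : Function.Bijective (Sum.elim P Q)) (hQ : IsUnit (M.submatrix Q Q))
    (hS : IsUnit (schur M P Q)) : IsUnit M := by
  set e := Equiv.ofBijective _ h with he
  have hM : M = (Matrix.fromBlocks (M.submatrix P P) (M.submatrix P Q) (M.submatrix Q P)
      (M.submatrix Q Q)).submatrix e.symm e.symm := by
    ext i j
    obtain ⟨x, rfl⟩ := e.surjective i
    obtain ⟨y, rfl⟩ := e.surjective j
    rw [Matrix.submatrix_apply, Equiv.symm_apply_apply, Equiv.symm_apply_apply]
    rcases x with x | x <;> rcases y with y | y <;> rfl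
  obtain ⟨⟨D, V, hDV, hVD⟩, hD⟩ := hQ
  obtain ⟨⟨S, W, hSW, hWS⟩, hS'⟩ := hS
  simp only at hD hS'
  subst hD
  have hV : Ring.inverse (M.submatrix Q Q) = V :=
    Ring.inverse_unit ⟨M.submatrix Q Q, V, hDV, hVD⟩
  rw [schur, hV] at hS'
  rw [hM]
  clear hM hV
  generalize M.submatrix P P = A at *
  generalize M.submatrix P Q = B at *
  generalize M.submatrix Q P = Cc at *
  generalize M.submatrix Q Q = D at *
  have hA : A = S + B * V * Cc := by rw [hS', sub_add_cancel]
  have hDV' : ∀ {k : ℕ} (Z : Matrix (Fin s) (Fin k) C), D * (V * Z) = Z := fun Z => by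
    rw [← Matrix.mul_assoc, hDV, Matrix.one_mul]
  have hSW' : ∀ {k : ℕ} (Z : Matrix (Fin m) (Fin k) C), S * (W * Z) = Z := fun Z => by
    rw [← Matrix.mul_assoc, hSW, Matrix.one_mul]
  subst hA
  clear hS'
  -- The block inverse obtained from the LDU factorization, with W = S⁻¹ and V = D⁻¹.
  refine isUnit_iff_exists.2 ⟨(Matrix.fromBlocks W (-(W * B * V)) (-(V * Cc * W))
    (V + V * Cc * W * B * V)).submatrix e.symm e.symm, ?_, ?_⟩
  all_goals
    rw [Matrix.submatrix_mul_equiv, Matrix.fromBlocks_multiply, ← Matrix.submatrix_one_equiv e.symm,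
      ← Matrix.fromBlocks_one]
    congr 2
    all_goals
      simp only [Matrix.mul_add, Matrix.add_mul, Matrix.mul_neg, Matrix.neg_mul, Matrix.mul_assoc,
        hDV', hSW', hDV, hVD, hSW, hWS, Matrix.mul_one]
      abel

theorem commute_of_inverse {m : ℕ} {N S : Matrix (Fin m) (Fin m) C} (hNS : N * S = 1)
    (hSN : S * N = 1) {z : C} (h : ∀ i j, Commute z (N i j)) (i j : Fin m) :
    Commute z (S i j) := by
  have h1 : Matrix.diagonal (fun _ => z) * N = N * Matrix.diagonal (fun _ => z) := by
    ext i j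
    rw [Matrix.diagonal_mul, Matrix.mul_diagonal, (h i j).eq]
  have h2 : Matrix.diagonal (fun _ => z) * S = S * Matrix.diagonal (fun _ => z) := by
    calc _ = S * N * (Matrix.diagonal (fun _ => z) * S) := by rw [hSN, one_mul]
      _ = S * (Matrix.diagonal (fun _ => z) * N) * S := by rw [h1]; simp only [mul_assoc]
      _ = _ := by simp only [mul_assoc, hNS, mul_one]
  have := congrFun (congrFun h2 i) j
  rwa [Matrix.diagonal_mul, Matrix.mul_diagonal] at this

end SchurComplement

/-! ### Invertibility from triangular constant terms -/

section Triangular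

variable {A : Type*} [Ring A]

open PowerSeries

/-- The matrix of constant terms is triangular, with invertible diagonal entries. -/
structure Triangular {n : ℕ} (M : Matrix (Fin n) (Fin n) A⟦X⟧) : Prop where
  off_diag : (∀ i j, i < j → constantCoeff (M i j) = 0) ∨ ∀ i j, i < j → constantCoeff (M j i) = 0
  diag : ∀ i, IsUnit (constantCoeff (M i i))

theorem Triangular.submatrix {n m : ℕ} {M : Matrix (Fin n) (Fin n) A⟦X⟧} (h : Triangular M)
    {f : Fin m → Fin n} (hf : StrictMono f) : Triangular (M.submatrix f f) where
  off_diag := h.off_diag.imp (fun h _ _ hij => h _ _ (hf hij)) fun h _ _ hij => h _ _ (hf hij)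
  diag _ := h.diag _

/-- Since P precedes Q, one of the blocks M_PQ and M_QP has zero constant term, which kills the
correction term. -/
theorem Triangular.constantCoeff_schur {n m s : ℕ} {M : Matrix (Fin n) (Fin n) A⟦X⟧}
    (h : Triangular M) {P : Fin m → Fin n} {Q : Fin s → Fin n} (hPQ : ∀ i k, P i < Q k)
    (i j : Fin m) : constantCoeff (schur M P Q i j) = constantCoeff (M (P i) (P j)) := by
  rw [schur_apply, map_sub, sub_eq_self, map_sum]
  refine Finset.sum_eq_zero fun k _ => ?_
  rw [map_sum]
  refine Finset.sum_eq_zero fun l _ => ?_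
  rw [map_mul, map_mul]
  rcases h.off_diag with h | h
  · rw [h _ _ (hPQ i l), zero_mul, zero_mul]
  · rw [h _ _ (hPQ j k), mul_zero]

theorem Triangular.schur {n m s : ℕ} {M : Matrix (Fin n) (Fin n) A⟦X⟧}
    (h : Triangular M) {P : Fin m → Fin n} {Q : Fin s → Fin n} (hP : StrictMono P)
    (hPQ : ∀ i k, P i < Q k) : Triangular (schur M P Q) where
  off_diag := by
    simp only [h.constantCoeff_schur hPQ]
    exact (h.submatrix hP).off_diag
  diag i := by
    rw [h.constantCoeff_schur hPQ]
    exact h.diag _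

theorem bijective_zero_succ (n : ℕ) :
    Function.Bijective (Sum.elim (fun _ : Fin 1 => (0 : Fin (n + 1))) Fin.succ) := by
  constructor
  · rintro (x | x) (y | y) h
    · simp [Subsingleton.elim x y]
    · exact absurd h (Fin.succ_ne_zero y).symm
    · exact absurd h (Fin.succ_ne_zero x)
    · simpa using h
  · intro x
    refine Fin.cases ⟨Sum.inl 0, rfl⟩ (fun y => ⟨Sum.inr y, rfl⟩) x

theorem isUnit_of_fin_one {N : Matrix (Fin 1) (Fin 1) A⟦X⟧} (h : IsUnit (N 0 0)) : IsUnit N := by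
  obtain ⟨⟨a, b, hab, hba⟩, ha⟩ := h
  refine ⟨⟨N, Matrix.of fun _ _ => b, ?_, ?_⟩, rfl⟩
  all_goals
    ext i j : 1
    fin_cases i
    fin_cases j
    simp_all [Matrix.mul_apply, ← ha]

/-- Split off the first index: the 1 × 1 Schur complement is a series with invertible constant term.
-/
theorem Triangular.isUnit {n : ℕ} {M : Matrix (Fin n) (Fin n) A⟦X⟧} (h : Triangular M) :
    IsUnit M := by
  induction n with
  | zero => exact isUnit_of_subsingleton M
  | succ n ih =>
    refine isUnit_of_isUnit_schur (bijective_zero_succ n) (ih (h.submatrix Fin.strictMono_succ))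
      (isUnit_of_fin_one ?_)
    rw [PowerSeries.isUnit_iff_constantCoeff, h.constantCoeff_schur (fun _ k => k.succ_pos)]
    exact h.diag 0

end Triangular

/-! ### Exchange and commutation relations for Schur complements -/

section Pairs

variable {A : Type*} [Ring A] [Algebra ℂ A]

open PowerSeries

theorem map_ringHom_mul {C D : Type*} [Ring C] [Ring D] (f : C →+* D) {n : ℕ}
    {M N : Matrix (Fin n) (Fin n) C} (h : M * N = 1) : M.map f * N.map f = 1 := by
  rw [← Matrix.map_mul, h, Matrix.map_one _ (map_zero f) (map_one f)]

variable {q : ℂ} {α β : A⟦X⟧⟦X⟧} {n m s : ℕ} {M N : Matrix (Fin n) (Fin n) A⟦X⟧}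
  {P : Fin m → Fin n} {Q : Fin s → Fin n}

/-- By `RTT.inverse_right_comm` the entries of M_QQ commute with those of (N⁻¹)_PP, hence with those
of its inverse, the Schur complement. -/
theorem RTT.coeffCommute_schur_right (hs : Spectral q α β)
    (h : RTT q α β (M.map inner) (N.map outer)) (hN : IsUnit N) (hNQ : IsUnit (N.submatrix Q Q))
    (hPQ : Function.Bijective (Sum.elim P Q)) (i j : Fin m) (k l : Fin s) :
    CoeffCommute (M (Q k) (Q l)) (schur N P Q i j) := by
  have hne : ∀ k i, Q k ≠ P i := fun k i e => by
    have := @hPQ.1 (Sum.inr k) (Sum.inl i) (by simpa using e)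
    simp at this
  have h1 := map_ringHom_mul outer (Ring.mul_inverse_cancel _ hN)
  have h2 := map_ringHom_mul outer (Ring.inverse_mul_cancel _ hN)
  have h3 := map_ringHom_mul outer (schur_mul_submatrix hPQ (Ring.mul_inverse_cancel _ hN) hNQ)
  have h4 := map_ringHom_mul outer (submatrix_mul_schur hPQ (Ring.inverse_mul_cancel _ hN) hNQ)
  rw [coeffCommute_iff]
  exact commute_of_inverse h4 h3
    (fun i j => (h.inverse_right_comm hs h1 h2 (hne k j) (hne l i).symm).symm) i j

/-- Unitarity interchanges the roles of M and N and reduces this to the previous argument. -/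
theorem RTT.coeffCommute_schur_left (hq : q ≠ 0) (hs : Spectral q α β)
    (h : RTT q α β (M.map inner) (N.map outer)) (hM : IsUnit M) (hMQ : IsUnit (M.submatrix Q Q))
    (hPQ : Function.Bijective (Sum.elim P Q)) (i j : Fin m) (k l : Fin s) :
    CoeffCommute (schur M P Q i j) (N (Q k) (Q l)) := by
  have hne : ∀ k i, Q k ≠ P i := fun k i e => by
    have := @hPQ.1 (Sum.inr k) (Sum.inl i) (by simpa using e)
    simp at this
  have h1 := map_ringHom_mul inner (Ring.mul_inverse_cancel _ hM)
  have h2 := map_ringHom_mul inner (Ring.inverse_mul_cancel _ hM)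
  have h3 := map_ringHom_mul inner (schur_mul_submatrix hPQ (Ring.mul_inverse_cancel _ hM) hMQ)
  have h4 := map_ringHom_mul inner (submatrix_mul_schur hPQ (Ring.inverse_mul_cancel _ hM) hMQ)
  rw [coeffCommute_iff]
  exact (commute_of_inverse h4 h3
    (fun i j => ((h.swap hq hs).inverse_right_comm hs.symm h1 h2 (hne k j) (hne l i).symm).symm)
    i j).symm

/-- Invert, restrict to P, invert again; the inverse of (M⁻¹)_PP is the Schur complement. -/
theorem RTT.schur (h : RTT q α β (M.map inner) (N.map outer)) (hM : IsUnit M) (hN : IsUnit N)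
    (hMQ : IsUnit (M.submatrix Q Q)) (hNQ : IsUnit (N.submatrix Q Q)) (hP : StrictMono P)
    (hPQ : Function.Bijective (Sum.elim P Q)) :
    RTT q α β ((schur M P Q).map inner) ((schur N P Q).map outer) := by
  have a1 := map_ringHom_mul inner (Ring.mul_inverse_cancel _ hM)
  have a2 := map_ringHom_mul inner (Ring.inverse_mul_cancel _ hM)
  have a3 := map_ringHom_mul outer (Ring.mul_inverse_cancel _ hN)
  have a4 := map_ringHom_mul outer (Ring.inverse_mul_cancel _ hN)
  have b1 := map_ringHom_mul inner (submatrix_mul_schur hPQ (Ring.inverse_mul_cancel _ hM) hMQ)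
  have b2 := map_ringHom_mul inner (schur_mul_submatrix hPQ (Ring.mul_inverse_cancel _ hM) hMQ)
  have b3 := map_ringHom_mul outer (submatrix_mul_schur hPQ (Ring.inverse_mul_cancel _ hN) hNQ)
  have b4 := map_ringHom_mul outer (schur_mul_submatrix hPQ (Ring.mul_inverse_cancel _ hN) hNQ)
  have h1 := h.inverse a1 a2 a3 a4
  have h2 : OpRTT q α β (((Ring.inverse M).submatrix P P).map inner)
      (((Ring.inverse N).submatrix P P).map outer) := OpRTT.submatrix h1 hP
  exact h2.inverse b1 b2 b3 b4

end Pairs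

/-! ### Quantum minors under commutation, rescaling and common factors -/

section Closure

variable {A : Type*} [Ring A] [Algebra ℂ A]

open PowerSeries

theorem CoeffCommute.minor_left {q p : ℂ} {n r : ℕ} {M : Matrix (Fin n) (Fin n) A⟦X⟧}
    {a b : Fin r → Fin n} {g : A⟦X⟧} (h : ∀ i j, CoeffCommute (M (a i) (b j)) g) :
    CoeffCommute (minor q p M a b) g := by
  refine CoeffCommute.sum_left fun σ _ => CoeffCommute.smul_left ?_ _
  refine CoeffCommute.list_prod_left fun f hf => ?_
  obtain ⟨k, rfl⟩ := (List.mem_ofFn' _ _).1 hf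
  exact (h _ _).scale_left _

theorem CoeffCommute.minor_right {q p : ℂ} {n r : ℕ} {M : Matrix (Fin n) (Fin n) A⟦X⟧}
    {a b : Fin r → Fin n} {f : A⟦X⟧} (h : ∀ i j, CoeffCommute f (M (a i) (b j))) :
    CoeffCommute f (minor q p M a b) :=
  (CoeffCommute.minor_left fun i j => (h i j).symm).symm

theorem CoeffCommute.mul_right {f g g' : A⟦X⟧} (h : CoeffCommute f g) (h' : CoeffCommute f g') :
    CoeffCommute f (g * g') := (h.symm.mul_left h'.symm).symm

theorem minor_map_scale (q p c : ℂ) {n r : ℕ} (M : Matrix (Fin n) (Fin n) A⟦X⟧)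
    (a b : Fin r → Fin n) : minor q p (M.map (scale c)) a b = scale c (minor q p M a b) := by
  simp only [minor, minorTerm, map_sum, map_smul, map_list_prod, List.map_ofFn, Matrix.map_apply,
    Function.comp_def, scale_scale, mul_comm]

theorem prod_ofFn_mul {R : Type*} [Monoid R] {m : ℕ} {f g : Fin m → R}
    (h : ∀ i j, Commute (g i) (f j)) :
    (List.ofFn fun k => f k * g k).prod = (List.ofFn f).prod * (List.ofFn g).prod := by
  induction m with
  | zero => simp
  | succ m ih =>
    have hc : Commute (g 0) (List.ofFn fun k : Fin m => f k.succ).prod := by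
      refine Commute.list_prod_right _ _ fun x hx => ?_
      obtain ⟨k, rfl⟩ := (List.mem_ofFn' _ _).1 hx
      exact h _ _
    simp only [List.ofFn_succ, List.prod_cons]
    rw [ih fun i j => h _ _, mul_assoc, ← mul_assoc (g 0), hc.eq]
    simp only [mul_assoc]

theorem minor_mul_left {q p : ℂ} {n r : ℕ} {D : A⟦X⟧} {M : Matrix (Fin n) (Fin n) A⟦X⟧}
    (h : ∀ i j, CoeffCommute D (M i j)) (a b : Fin r → Fin n) :
    minor q p (Matrix.of fun i j => D * M i j) a b =
      (List.ofFn fun k : Fin r => scale (p ^ (k : ℕ)) D).prod * minor q p M a b := by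
  simp only [minor, Finset.mul_sum, minorTerm, mul_smul_comm]
  refine Finset.sum_congr rfl fun σ _ => ?_
  rw [← prod_ofFn_mul]
  · simp
  · intro i j
    exact (((h _ _).scale_left _).scale_right _).symm.commute

end Closure

/-! ### Multiplying a solution of the exchange relation by commuting factors -/

section Rescaling

variable {B : Type*} [Ring B] [Algebra ℂ B]

theorem RTT.mul_left {q : ℂ} {α β : B} (hs : Spectral q α β) {n : ℕ}
    {X Y : Matrix (Fin n) (Fin n) B} (h : RTT q α β X Y) {D D' : B} (hD : Commute D D')
    (hY : ∀ i j, Commute D (Y i j)) (hX : ∀ i j, Commute D' (X i j)) :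
    RTT q α β (Matrix.of fun i j => D * X i j) (Matrix.of fun i j => D' * Y i j) := by
  intro a b c d
  have e1 : ∀ a c b d, D * X a c * (D' * Y b d) = D * D' * (X a c * Y b d) := fun a c b d => by
    rw [mul_assoc, ← mul_assoc (X a c), ← (hX a c).eq]
    simp only [mul_assoc]
  have e2 : ∀ a c b d, D' * Y b d * (D * X a c) = D * D' * (Y b d * X a c) := fun a c b d => by
    rw [mul_assoc, ← mul_assoc (Y b d), ← (hY b d).eq, hD.eq]
    simp only [mul_assoc]
  have e3 : ∀ r z : B, Commute r (D * D') → r * (D * D' * z) = D * D' * (r * z) :=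
    fun r z hr => by rw [← mul_assoc, hr.eq, mul_assoc]
  simp only [Matrix.of_apply, e1, e2]
  rw [e3 _ _ (hs.rDiag_comm a b _), e3 _ _ (hs.rOff_comm a b _), mul_assoc (D * D'),
    mul_assoc (D * D'), ← mul_add, h a b c d, mul_add]

end Rescaling

/-! ### The matrix of minors: exchange relation and quantum determinant -/

section Lax

variable {A : Type*} [Ring A] [Algebra ℂ A]

open PowerSeries

/-- A matrix of series satisfying the exchange relation, with triangular matrix of constant
terms. -/
structure IsLax (q p : ℂ) (α β : A⟦X⟧⟦X⟧) {n : ℕ} (M : Matrix (Fin n) (Fin n) A⟦X⟧) : Prop where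
  q_ne : q ≠ 0
  q_sq_ne : q ^ 2 ≠ 1
  spectral : Spectral q α β
  specializes : ∃ k, SpecializesTo q p k α β
  rtt : RTT q α β (M.map inner) (M.map outer)
  triangular : Triangular M

/-- The indices are cut into the initial segment `P` and the final segment `Q`. -/
structure IsCut {n m s : ℕ} (P : Fin m → Fin n) (Q : Fin s → Fin n) : Prop where
  mono_left : StrictMono P
  mono_right : StrictMono Q
  lt : ∀ i k, P i < Q k
  bijective : Function.Bijective (Sum.elim P Q)

theorem isCut_zero_succ (n : ℕ) : IsCut (fun _ : Fin 1 => (0 : Fin (n + 1))) Fin.succ where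
  mono_left _ _ h := absurd h (by simp [Subsingleton.elim _ (0 : Fin 1)])
  mono_right := Fin.strictMono_succ
  lt _ k := k.succ_pos
  bijective := bijective_zero_succ n

theorem isCut_of_val {n m s : ℕ} {P : Fin m → Fin n} {Q : Fin s → Fin n} (hn : n = m + s)
    (hP : ∀ i, (P i : ℕ) = i) (hQ : ∀ k, (Q k : ℕ) = m + k) : IsCut P Q where
  mono_left i j h := by simp only [Fin.lt_def, hP] at *; exact h
  mono_right i j h := by simp only [Fin.lt_def, hQ] at *; omega
  lt i k := by simp only [Fin.lt_def, hP, hQ]; omega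
  bijective := by
    constructor
    · rintro (i | i) (j | j) h <;> simp only [Sum.elim_inl, Sum.elim_inr, Fin.ext_iff, hP, hQ] at h
      · rw [Fin.ext h]
      · omega
      · omega
      · rw [Fin.ext (by omega : (i : ℕ) = j)]
    · intro x
      by_cases h : (x : ℕ) < m
      · exact ⟨Sum.inl ⟨x, h⟩, Fin.ext (by simp [hP])⟩
      · exact ⟨Sum.inr ⟨x - m, by omega⟩, Fin.ext (by simp [hQ]; omega)⟩

variable {q p : ℂ} {α β : A⟦X⟧⟦X⟧} {n m s : ℕ} {M : Matrix (Fin n) (Fin n) A⟦X⟧}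
  {P : Fin m → Fin n} {Q : Fin s → Fin n}

theorem IsLax.colAntisymm (h : IsLax q p α β M) : ColAntisymm q p M :=
  let ⟨_, hk⟩ := h.specializes
  h.rtt.colAntisymm h.q_ne h.q_sq_ne h.spectral hk

theorem IsLax.submatrix (h : IsLax q p α β M) (hP : StrictMono P) :
    IsLax q p α β (M.submatrix P P) where
  q_ne := h.q_ne
  q_sq_ne := h.q_sq_ne
  spectral := h.spectral
  specializes := h.specializes
  rtt := h.rtt.submatrix hP
  triangular := h.triangular.submatrix hP

theorem IsLax.isUnit (h : IsLax q p α β M) : IsUnit M := h.triangular.isUnit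

theorem IsLax.isUnit_submatrix (h : IsLax q p α β M) (hP : StrictMono P) :
    IsUnit (M.submatrix P P) := (h.submatrix hP).isUnit

theorem IsLax.schur (h : IsLax q p α β M) (c : IsCut P Q) : IsLax q p α β (schur M P Q) where
  q_ne := h.q_ne
  q_sq_ne := h.q_sq_ne
  spectral := h.spectral
  specializes := h.specializes
  rtt := h.rtt.schur h.isUnit h.isUnit (h.isUnit_submatrix c.mono_right)
    (h.isUnit_submatrix c.mono_right) c.mono_left c.bijective
  triangular := h.triangular.schur c.mono_left c.lt

theorem IsLax.minor_cons (h : IsLax q p α β M) (c : IsCut P Q) (i j : Fin m) :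
    minor q p M (Fin.cons (P i) Q) (Fin.cons (P j) Q) =
      minor q p M Q Q * scale (p ^ s) (QuantumSylvester.schur M P Q i j) := by
  rw [schur_apply, QuantumSylvester.minor_cons h.q_ne h.colAntisymm c.mono_right
    (Ring.mul_inverse_cancel _ (h.isUnit_submatrix c.mono_right)) (c.lt i) (c.lt j)]

theorem cons_zero_succ (n : ℕ) : (Fin.cons 0 Fin.succ : Fin (n + 1) → Fin (n + 1)) = id := by
  funext k
  refine Fin.cases rfl (fun k => rfl) k

/-- The quantum determinant as a product of the one of a principal submatrix and a
quasideterminant. -/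
theorem IsLax.minor_id_succ {M : Matrix (Fin (n + 1)) (Fin (n + 1)) A⟦X⟧}
    (h : IsLax q p α β M) :
    minor q p M id id = minor q p (M.submatrix Fin.succ Fin.succ) id id *
      scale (p ^ n) (QuantumSylvester.schur M (fun _ : Fin 1 => 0) Fin.succ 0 0) := by
  have := h.minor_cons (isCut_zero_succ n) 0 0
  rwa [cons_zero_succ] at this

theorem constantCoeff_scale (c : ℂ) (f : A⟦X⟧) : constantCoeff (scale c f) = constantCoeff f := by
  rw [← coeff_zero_eq_constantCoeff_apply, coeff_scale]
  simp

theorem IsLax.constantCoeff_minor_cons (h : IsLax q p α β M) (c : IsCut P Q) (i j : Fin m) :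
    constantCoeff (minor q p M (Fin.cons (P i) Q) (Fin.cons (P j) Q)) =
      constantCoeff (minor q p M Q Q) * constantCoeff (M (P i) (P j)) := by
  rw [h.minor_cons c, map_mul, constantCoeff_scale, h.triangular.constantCoeff_schur c.lt]

theorem IsLax.constantCoeff_minor_id_succ {M : Matrix (Fin (n + 1)) (Fin (n + 1)) A⟦X⟧}
    (h : IsLax q p α β M) :
    constantCoeff (minor q p M id id) =
      constantCoeff (minor q p (M.submatrix Fin.succ Fin.succ) id id) * constantCoeff (M 0 0) := by
  have := h.constantCoeff_minor_cons (isCut_zero_succ n) 0 0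
  rwa [cons_zero_succ] at this

/-- Two matrices related by an exchange relation. -/
structure LaxPair (q p p' : ℂ) (α β : A⟦X⟧⟦X⟧) {n : ℕ} (M N : Matrix (Fin n) (Fin n) A⟦X⟧) :
    Prop where
  left : ∃ α' β', IsLax q p α' β' M
  right : ∃ α' β', IsLax q p' α' β' N
  spectral : Spectral q α β
  rtt : RTT q α β (M.map inner) (N.map outer)

variable {p' : ℂ} {N : Matrix (Fin n) (Fin n) A⟦X⟧}

theorem IsLax.laxPair (h : IsLax q p α β M) : LaxPair q p p α β M M where
  left := ⟨_, _, h⟩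
  right := ⟨_, _, h⟩
  spectral := h.spectral
  rtt := h.rtt

theorem LaxPair.submatrix (h : LaxPair q p p' α β M N) (hP : StrictMono P) :
    LaxPair q p p' α β (M.submatrix P P) (N.submatrix P P) where
  left := let ⟨_, _, h⟩ := h.left; ⟨_, _, h.submatrix hP⟩
  right := let ⟨_, _, h⟩ := h.right; ⟨_, _, h.submatrix hP⟩
  spectral := h.spectral
  rtt := h.rtt.submatrix hP

theorem LaxPair.rtt_schur (h : LaxPair q p p' α β M N) (c : IsCut P Q) :
    RTT q α β ((schur M P Q).map inner) ((schur N P Q).map outer) := by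
  obtain ⟨_, _, h1⟩ := h.left
  obtain ⟨_, _, h2⟩ := h.right
  exact h.rtt.schur h1.isUnit h2.isUnit (h1.isUnit_submatrix c.mono_right)
    (h2.isUnit_submatrix c.mono_right) c.mono_left c.bijective

theorem LaxPair.coeffCommute_minor_schur (h : LaxPair q p p' α β M N) (c : IsCut P Q)
    (i j : Fin m) : CoeffCommute (minor q p M Q Q) (schur N P Q i j) := by
  obtain ⟨_, _, h2⟩ := h.right
  exact CoeffCommute.minor_left fun k l => h.rtt.coeffCommute_schur_right h.spectral h2.isUnit
    (h2.isUnit_submatrix c.mono_right) c.bijective i j k l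

theorem LaxPair.coeffCommute_schur_minor (h : LaxPair q p p' α β M N) (c : IsCut P Q)
    (i j : Fin m) : CoeffCommute (schur M P Q i j) (minor q p' N Q Q) := by
  obtain ⟨_, _, h1⟩ := h.left
  exact CoeffCommute.minor_right fun k l => h.rtt.coeffCommute_schur_left h1.q_ne h.spectral
    h1.isUnit (h1.isUnit_submatrix c.mono_right) c.bijective i j k l

/-- Quantum determinants commute. -/
theorem LaxPair.coeffCommute_minor (h : LaxPair q p p' α β M N) :
    CoeffCommute (minor q p M id id) (minor q p' N id id) := by
  induction n with
  | zero => simpa only [minor_zero] using CoeffCommute.one_left _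
  | succ n ih =>
    have c := isCut_zero_succ n
    obtain ⟨_, _, h1⟩ := h.left
    obtain ⟨_, _, h2⟩ := h.right
    -- Each determinant is a smaller determinant times a quasideterminant. The quasideterminants
    -- commute by the 1 × 1 exchange relation, the mixed pairs by block commutation, the smaller
    -- determinants by induction.
    have hS : CoeffCommute (schur M (fun _ : Fin 1 => 0) Fin.succ 0 0)
        (schur N (fun _ : Fin 1 => 0) Fin.succ 0 0) := by
      rw [coeffCommute_iff]
      exact (h.rtt_schur c).comm_of_one h.spectral
    rw [h1.minor_id_succ, h2.minor_id_succ]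
    refine CoeffCommute.mul_left (CoeffCommute.mul_right (ih (h.submatrix c.mono_right)) ?_)
      (CoeffCommute.mul_right ?_ ?_)
    · exact (h.coeffCommute_minor_schur c 0 0).scale_right _
    · exact (h.coeffCommute_schur_minor c 0 0).scale_left _
    · exact (hS.scale_left _).scale_right _

theorem LaxPair.coeffCommute_minor_of_strictMono (h : LaxPair q p p' α β M N)
    (hQ : StrictMono Q) : CoeffCommute (minor q p M Q Q) (minor q p' N Q Q) :=
  (h.submatrix hQ).coeffCommute_minor

/-- The matrix of quantum minors with rows `P i, Q` and columns `P j, Q`. -/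
def flat (q p : ℂ) (M : Matrix (Fin n) (Fin n) A⟦X⟧) (P : Fin m → Fin n) (Q : Fin s → Fin n) :
    Matrix (Fin m) (Fin m) A⟦X⟧ :=
  Matrix.of fun i j => minor q p M (Fin.cons (P i) Q) (Fin.cons (P j) Q)

theorem IsLax.flat_eq (h : IsLax q p α β M) (c : IsCut P Q) :
    flat q p M P Q = Matrix.of fun i j =>
      minor q p M Q Q * (QuantumSylvester.schur M P Q).map (scale (p ^ s)) i j := by
  exact Matrix.ext fun i j => h.minor_cons c i j

/-- The spectral parameters are homogeneous under rescaling of the variables. -/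
def IsHomogeneous (α β : A⟦X⟧⟦X⟧) (c d : ℂ) : Prop :=
  ∃ k : ℂ, k ≠ 0 ∧ scaleBoth c d α = k • α ∧ scaleBoth c d β = k • β

/-- This absorbs the shift of argument in D(u)S(q^{-2s}u): rescaling multiplies R by a nonzero
scalar. -/
theorem RTT.map_scale {c d : ℂ} (hh : IsHomogeneous α β c d)
    (h : RTT q α β (M.map inner) (N.map outer)) :
    RTT q α β ((M.map (scale c)).map inner) ((N.map (scale d)).map outer) := by
  obtain ⟨k, hk, hα, hβ⟩ := hh
  have := h.map (scaleBoth c d)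
  rw [hα, hβ] at this
  have h1 : (M.map inner).map (scaleBoth c d) = (M.map (scale c)).map inner := 
    Matrix.ext fun i j => scaleBoth_inner _ _ _
  have h2 : (N.map outer).map (scaleBoth c d) = (N.map (scale d)).map outer := 
    Matrix.ext fun i j => scaleBoth_outer _ _ _
  rw [h1, h2] at this
  exact this.of_smul hk

theorem LaxPair.rtt_flat (h : LaxPair q p p' α β M N) (c : IsCut P Q)
    (hh : IsHomogeneous α β (p ^ s) (p' ^ s)) :
    RTT q α β ((flat q p M P Q).map inner) ((flat q p' N P Q).map outer) := by
  obtain ⟨_, _, h1⟩ := h.left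
  obtain ⟨_, _, h2⟩ := h.right
  have := ((h.rtt_schur c).map_scale hh).mul_left h.spectral
    (coeffCommute_iff.1 (h.coeffCommute_minor_of_strictMono c.mono_right))
    (fun i j => coeffCommute_iff.1 ((h.coeffCommute_minor_schur c i j).scale_right _))
    (fun i j => (coeffCommute_iff.1 ((h.coeffCommute_schur_minor c i j).scale_left _)).symm)
  rw [h1.flat_eq c, h2.flat_eq c]
  intro a b c d
  simpa using this a b c d

theorem constantCoeff_commute {f g : A⟦X⟧} (h : CoeffCommute f g) :
    Commute (constantCoeff f) (constantCoeff g) := by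
  simpa using h 0 0

theorem LaxPair.constantCoeff_flat_mul (h : LaxPair q p p' α β M N) (c : IsCut P Q)
    (hMN : ∀ i, constantCoeff (M i i) * constantCoeff (N i i) = 1)
    (hd : constantCoeff (minor q p M Q Q) * constantCoeff (minor q p' N Q Q) = 1) (i : Fin m) :
    constantCoeff (flat q p M P Q i i) * constantCoeff (flat q p' N P Q i i) = 1 := by
  obtain ⟨_, _, h1⟩ := h.left
  obtain ⟨_, _, h2⟩ := h.right
  have hc := constantCoeff_commute (h.coeffCommute_schur_minor c i i)
  rw [h1.triangular.constantCoeff_schur c.lt] at hc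
  simp only [flat, Matrix.of_apply, h1.constantCoeff_minor_cons c, h2.constantCoeff_minor_cons c]
  rw [mul_assoc, ← mul_assoc (constantCoeff (M _ _)), hc.eq, mul_assoc, hMN, mul_one, hd]

theorem LaxPair.constantCoeff_minor_mul (h : LaxPair q p p' α β M N)
    (hMN : ∀ i, constantCoeff (M i i) * constantCoeff (N i i) = 1) :
    constantCoeff (minor q p M id id) * constantCoeff (minor q p' N id id) = 1 := by
  induction n with
  | zero => simp [minor_zero]
  | succ n ih =>
    have h' := ih (h.submatrix Fin.strictMono_succ) fun i => hMN i.succ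
    rw [minor_submatrix, minor_submatrix] at h'
    have := h.constantCoeff_flat_mul (isCut_zero_succ n) hMN h' 0
    simp only [flat, Matrix.of_apply] at this
    rwa [cons_zero_succ] at this

/-- The quantum determinant as the product of the ones of a principal submatrix and of its Schur
complement. -/
theorem IsLax.minor_eq_mul_schur (h : IsLax q p α β M) (hn : n = m + s)
    (hP : ∀ i, (P i : ℕ) = i) (hQ : ∀ k, (Q k : ℕ) = m + k) :
    minor q p M id id =
      minor q p M Q Q * scale (p ^ s) (minor q p (QuantumSylvester.schur M P Q) id id) := by
  induction m generalizing n with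
  | zero =>
    obtain rfl : n = s := by omega
    have : Q = id := funext fun k => Fin.ext (by simp [hQ])
    rw [minor_zero, map_one, mul_one, this]
  | succ m ih =>
    obtain ⟨n, rfl⟩ : ∃ n', n = n' + 1 := ⟨m + s, by omega⟩
    have cut := isCut_of_val hn hP hQ
    set P' : Fin m → Fin n := fun i => ⟨i, by omega⟩ with hP'
    set Q' : Fin s → Fin n := fun k => ⟨m + k, by omega⟩ with hQ'
    have eP : P ∘ Fin.succ = Fin.succ ∘ P' := funext fun i => Fin.ext (by simp [hP, hP'])
    have eQ : Q = Fin.succ ∘ Q' := funext fun k => Fin.ext (by simp [hQ, hQ']; omega)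
    have eP0 : P 0 = 0 := Fin.ext (by simp [hP])
    have eS : QuantumSylvester.schur (M.submatrix Fin.succ Fin.succ) P' Q' =
        (QuantumSylvester.schur M P Q).submatrix Fin.succ Fin.succ := by
      have e : ∀ i, (P' i).succ = P i.succ := fun i => (congrFun eP i).symm
      refine Matrix.ext fun i j => ?_
      rw [Matrix.submatrix_apply, schur_apply, schur_apply, eQ]
      simp only [Matrix.submatrix_apply, e, Function.comp_apply, Matrix.submatrix_submatrix]
    have hS := h.schur cut
    -- Both sides invert the (0,0) entry of M⁻¹, so heredity of quasideterminants follows from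
    -- uniqueness of inverses.
    have eq00 : QuantumSylvester.schur M (fun _ : Fin 1 => 0) Fin.succ 0 0 =
        QuantumSylvester.schur (QuantumSylvester.schur M P Q) (fun _ : Fin 1 => 0) Fin.succ 0 0 := by
      have a1 := schur_mul_submatrix (isCut_zero_succ n).bijective
        (Ring.mul_inverse_cancel _ h.isUnit) (h.isUnit_submatrix Fin.strictMono_succ)
      have a2 := submatrix_mul_schur (isCut_zero_succ m).bijective
        (submatrix_mul_schur cut.bijective (Ring.inverse_mul_cancel _ h.isUnit)
          (h.isUnit_submatrix cut.mono_right)) (hS.isUnit_submatrix Fin.strictMono_succ)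
      have e : ((Ring.inverse M).submatrix P P).submatrix (fun _ : Fin 1 => (0 : Fin (m + 1)))
          (fun _ : Fin 1 => (0 : Fin (m + 1))) =
          (Ring.inverse M).submatrix (fun _ : Fin 1 => (0 : Fin (n + 1))) fun _ => 0 := by
        rw [Matrix.submatrix_submatrix]
        simp only [Function.comp_def, eP0]
      rw [e] at a2
      rw [left_inv_eq_right_inv a1 a2]
    rw [h.minor_id_succ, hS.minor_id_succ, ih (P := P') (Q := Q')
      (h.submatrix Fin.strictMono_succ) (by omega) (fun _ => rfl) (fun _ => rfl), eS, eq00, map_mul,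
      scale_scale, ← pow_add, mul_assoc, minor_submatrix, ← eQ, show s + m = n by omega]

/-- The quantum determinant of the matrix of quantum minors containing a fixed block. -/
theorem IsLax.minor_flat (h : IsLax q p α β M) (hm : 1 ≤ m) (hn : n = m + s)
    (hP : ∀ i, (P i : ℕ) = i) (hQ : ∀ k, (Q k : ℕ) = m + k) :
    minor q p (QuantumSylvester.flat q p M P Q) id id =
      minor q p M id id *
        (List.ofFn fun k : Fin (m - 1) => scale (p ^ ((k : ℕ) + 1)) (minor q p M Q Q)).prod := by
  have cut := isCut_of_val hn hP hQ
  have hc : ∀ i j, CoeffCommute (minor q p M Q Q)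
      ((QuantumSylvester.schur M P Q).map (scale (p ^ s)) i j) := fun i j =>
    (h.laxPair.coeffCommute_minor_schur cut i j).scale_right _
  -- Of the m shifted factors D pulled out, the unshifted one joins the determinant of the Schur
  -- complement to form qdet M; the other m − 1 commute past the latter.
  rw [h.flat_eq cut, minor_mul_left hc, h.minor_eq_mul_schur hn hP hQ, minor_map_scale]
  obtain ⟨m, rfl⟩ : ∃ m', m = m' + 1 := ⟨m - 1, by omega⟩
  rw [List.ofFn_succ, List.prod_cons]
  have hcomm : Commute
      (List.ofFn fun k : Fin m => scale (p ^ ((k : ℕ) + 1)) (minor q p M Q Q)).prod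
      (scale (p ^ s) (minor q p (QuantumSylvester.schur M P Q) id id)) := by
    rw [← minor_map_scale]
    refine CoeffCommute.commute (CoeffCommute.minor_right fun i j => ?_)
    refine CoeffCommute.list_prod_left fun f hf => ?_
    obtain ⟨k, rfl⟩ := (List.mem_ofFn' _ _).1 hf
    exact (hc _ _).scale_left _
  simp only [Fin.val_zero, pow_zero, scale_one, Fin.val_succ, mul_assoc]
  rw [hcomm.eq]
  rfl

end Lax

/-! ### From series identities to coefficientwise relations -/

section Coefficients

variable {A : Type*} [Ring A] [Algebra ℂ A]

open PowerSeries

/-- The coefficient of a power series at an integer, zero at the negative ones. -/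
def intCoeff (f : A⟦X⟧) (k : ℤ) : A := if 0 ≤ k then coeff k.toNat f else 0

/-- The coefficient of `xⁱyʲ` for integers `i`, `j`. -/
def intCoeff₂ (i j : ℤ) : A⟦X⟧⟦X⟧ →ₗ[ℂ] A where
  toFun F := if 0 ≤ i ∧ 0 ≤ j then coeff i.toNat (coeff j.toNat F) else 0
  map_add' F G := by split_ifs <;> simp
  map_smul' c F := by split_ifs <;> simp

theorem intCoeff₂_apply (i j : ℤ) (F : A⟦X⟧⟦X⟧) : intCoeff₂ i j F =
    if 0 ≤ i ∧ 0 ≤ j then coeff i.toNat (coeff j.toNat F) else 0 := rfl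

theorem ext_intCoeff₂ {F G : A⟦X⟧⟦X⟧} (h : ∀ i j, intCoeff₂ i j F = intCoeff₂ i j G) : F = G := by
  ext j i
  simpa [intCoeff₂_apply] using h i j

theorem intCoeff₂_inner_mul_outer (f g : A⟦X⟧) (i j : ℤ) :
    intCoeff₂ i j (inner f * outer g) = intCoeff f i * intCoeff g j := by
  rw [intCoeff₂_apply, coeff_inner_mul_outer, intCoeff, intCoeff]
  by_cases hi : 0 ≤ i <;> by_cases hj : 0 ≤ j <;> simp [hi, hj]

theorem intCoeff₂_outer_mul_inner (f g : A⟦X⟧) (i j : ℤ) :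
    intCoeff₂ i j (outer g * inner f) = intCoeff g j * intCoeff f i := by
  rw [intCoeff₂_apply, coeff_outer_mul_inner, intCoeff, intCoeff]
  by_cases hi : 0 ≤ i <;> by_cases hj : 0 ≤ j <;> simp [hi, hj]

theorem intCoeff₂_varX_mul (F : A⟦X⟧⟦X⟧) (i j : ℤ) :
    intCoeff₂ i j (varX * F) = intCoeff₂ (i - 1) j F := by
  rw [intCoeff₂_apply, intCoeff₂_apply]
  by_cases hj : 0 ≤ j
  · rcases lt_trichotomy i 0 with hi | rfl | hi
    · rw [if_neg (by omega), if_neg (by omega)]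
    · rw [if_pos ⟨le_rfl, hj⟩, if_neg (by omega)]
      exact coeff_varX_mul_zero _ _
    · rw [if_pos ⟨by omega, hj⟩, if_pos ⟨by omega, hj⟩,
        show i.toNat = (i - 1).toNat + 1 by omega, coeff_varX_mul_succ]
  · rw [if_neg (by omega), if_neg (by omega)]

theorem intCoeff₂_varY_mul (F : A⟦X⟧⟦X⟧) (i j : ℤ) :
    intCoeff₂ i j (varY * F) = intCoeff₂ i (j - 1) F := by
  rw [intCoeff₂_apply, intCoeff₂_apply]
  by_cases hi : 0 ≤ i
  · rcases lt_trichotomy j 0 with hj | rfl | hj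
    · rw [if_neg (by omega), if_neg (by omega)]
    · rw [if_pos ⟨hi, le_rfl⟩, if_neg (by omega)]
      exact coeff_varY_mul_zero _ _
    · rw [if_pos ⟨hi, by omega⟩, if_pos ⟨hi, by omega⟩,
        show j.toNat = (j - 1).toNat + 1 by omega, coeff_varY_mul_succ]
  · rw [if_neg (by omega), if_neg (by omega)]

variable {B : Type*} [Ring B] [Algebra ℂ B]

theorem rDiag_eq_smul (q : ℂ) (α β : B) {n : ℕ} (a b : Fin n) :
    rDiag q α β a b = rDiag q (1 : ℂ) 0 a b • α + rDiag q (0 : ℂ) 1 a b • β := by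
  unfold rDiag
  split_ifs <;> simp [sub_eq_add_neg]

theorem rOff_eq_smul (q : ℂ) (α β : B) {n : ℕ} (a b : Fin n) :
    rOff q α β a b = rOff q (1 : ℂ) 0 a b • α + rOff q (0 : ℂ) 1 a b • β := by
  unfold rOff
  split_ifs <;> simp

theorem sum_single_kronecker_self {n : ℕ} (r : Fin n → Fin n → Prop) [DecidableRel r]
    (a b c d : Fin n) :
    (∑ i, ∑ j, if r i j then Matrix.single i i (1 : ℂ) ⊗ₖ Matrix.single j j (1 : ℂ) else 0)
      (a, b) (c, d) = if (a = c ∧ b = d) ∧ r a b then 1 else 0 := by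
  simp only [Matrix.sum_apply]
  rw [Finset.sum_eq_single a, Finset.sum_eq_single b]
  · by_cases h : r a b <;> simp [h, Matrix.single_apply, ← ite_and]
    congr 1
    simp [and_comm]
  · intro j _ hj
    split_ifs <;> simp [Matrix.single_apply, hj]
  · simp
  · intro i _ hi
    refine Finset.sum_eq_zero fun j _ => ?_
    split_ifs <;> simp [Matrix.single_apply, hi]
  · simp

theorem sum_single_kronecker_swap {n : ℕ} (r : Fin n → Fin n → Prop) [DecidableRel r]
    (a b c d : Fin n) :
    (∑ i, ∑ j, if r i j then Matrix.single i j (1 : ℂ) ⊗ₖ Matrix.single j i (1 : ℂ) else 0)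
      (a, b) (c, d) = if (a = d ∧ b = c) ∧ r a b then 1 else 0 := by
  simp only [Matrix.sum_apply]
  rw [Finset.sum_eq_single a, Finset.sum_eq_single b]
  · by_cases h : r a b <;> simp [h, Matrix.single_apply, ← ite_and]
  · intro j _ hj
    split_ifs <;> simp [Matrix.single_apply, hj]
  · simp
  · intro i _ hi
    refine Finset.sum_eq_zero fun j _ => ?_
    split_ifs <;> simp [Matrix.single_apply, hi]
  · simp

theorem sum_single_kronecker_diag {n : ℕ} (a b c d : Fin n) :
    (∑ i, Matrix.single i i (1 : ℂ) ⊗ₖ Matrix.single i i (1 : ℂ))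
      (a, b) (c, d) = if (a = c ∧ b = d) ∧ a = b then 1 else 0 := by
  have h := sum_single_kronecker_self (fun i j : Fin n => i = j) a b c d
  simpa using h

theorem rMatrix_eq_rMat (q : ℂ) (n : ℕ) (u v : ℂ) : rMatrix q n u v = rMat q u v n := by
  ext ⟨a, b⟩ ⟨c, d⟩
  rw [rMat_apply, rMatrix]
  simp only [Matrix.add_apply, Matrix.smul_apply, sum_single_kronecker_diag]
  rw [sum_single_kronecker_self (fun i j => i ≠ j), sum_single_kronecker_swap (fun i j => j < i),
    sum_single_kronecker_swap (fun i j => i < j), rDiag, rOff]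
  rcases lt_trichotomy a b with h | rfl | h
  · simp only [h, h.ne, h.not_gt, if_false, smul_eq_mul, ne_eq, not_false_eq_true,
      and_true, and_false]
    split_ifs <;> ring
  · simp only [lt_irrefl, if_true, if_false, smul_eq_mul, ne_eq, not_true, and_true, and_false]
    split_ifs <;> ring
  · simp only [h, h.ne', h.not_gt, if_true, if_false, smul_eq_mul, ne_eq, not_false_eq_true,
      and_true, and_false]
    split_ifs <;> ring

theorem algebraMap_rDiag (q u v : ℂ) {n : ℕ} (a b : Fin n) :
    rDiag q (algebraMap ℂ B u) (algebraMap ℂ B v) a b = algebraMap ℂ B (rDiag q u v a b) := by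
  unfold rDiag
  split_ifs <;> simp [Algebra.smul_def]

theorem algebraMap_rOff (q u v : ℂ) {n : ℕ} (a b : Fin n) :
    rOff q (algebraMap ℂ B u) (algebraMap ℂ B v) a b = algebraMap ℂ B (rOff q u v a b) := by
  unfold rOff
  split_ifs <;> simp [Algebra.smul_def]

theorem rMatrixIn_eq_rMat (q : ℂ) (n : ℕ) (u v : ℂ) :
    rMatrixIn B q n u v = rMat q (algebraMap ℂ B u) (algebraMap ℂ B v) n := by
  ext ⟨a, b⟩ ⟨c, d⟩
  rw [rMatrixIn, rMatrix_eq_rMat, Matrix.map_apply, rMat_apply, rMat_apply, algebraMap_rDiag,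
    algebraMap_rOff]
  split_ifs <;> simp

theorem rxyCoeff_apply (q : ℂ) {n : ℕ} (X Y : ℤ → Matrix (Fin n) (Fin n) B) (k l : ℤ)
    (a b c d : Fin n) : rxyCoeff q X Y k l (a, b) (c, d) =
      rDiag q (1 : ℂ) 0 a b • (X (k - 1) a c * Y l b d) +
      rOff q (1 : ℂ) 0 a b • (X (k - 1) b c * Y l a d) +
      (rDiag q (0 : ℂ) 1 a b • (X k a c * Y (l - 1) b d) +
      rOff q (0 : ℂ) 1 a b • (X k b c * Y (l - 1) a d)) := by
  rw [rxyCoeff, Matrix.add_apply, mul_assoc, mul_assoc, rMatrixIn_eq_rMat, rMatrixIn_eq_rMat,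
    rMat_mul_apply, rMat_mul_apply]
  simp only [inFirst_mul_inSecond_apply, algebraMap_rDiag, algebraMap_rOff, ← Algebra.smul_def]

theorem yxrCoeff_apply (q : ℂ) {n : ℕ} (X Y : ℤ → Matrix (Fin n) (Fin n) B) (k l : ℤ)
    (a b c d : Fin n) : yxrCoeff q X Y k l (a, b) (c, d) =
      rDiag q (1 : ℂ) 0 c d • (Y l b d * X (k - 1) a c) +
      rOff q (1 : ℂ) 0 d c • (Y l b c * X (k - 1) a d) +
      (rDiag q (0 : ℂ) 1 c d • (Y (l - 1) b d * X k a c) +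
      rOff q (0 : ℂ) 1 d c • (Y (l - 1) b c * X k a d)) := by
  rw [yxrCoeff, Matrix.add_apply, rMatrixIn_eq_rMat, rMatrixIn_eq_rMat,
    mul_rMat_apply, mul_rMat_apply]
  simp only [inSecond_mul_inFirst_apply, algebraMap_rDiag, algebraMap_rOff, ← Algebra.commutes,
    ← Algebra.smul_def]

theorem map_rxyCoeff {B' : Type*} [Ring B'] [Algebra ℂ B'] (f : B →ₐ[ℂ] B') (q : ℂ) {n : ℕ}
    (X Y : ℤ → Matrix (Fin n) (Fin n) B) (k l : ℤ) (a b : Fin n × Fin n) :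
    f (rxyCoeff q X Y k l a b) =
      rxyCoeff q (fun k => (X k).map f) (fun k => (Y k).map f) k l a b := by
  obtain ⟨a, a'⟩ := a
  obtain ⟨b, b'⟩ := b
  simp [rxyCoeff_apply]

theorem map_yxrCoeff {B' : Type*} [Ring B'] [Algebra ℂ B'] (f : B →ₐ[ℂ] B') (q : ℂ) {n : ℕ}
    (X Y : ℤ → Matrix (Fin n) (Fin n) B) (k l : ℤ) (a b : Fin n × Fin n) :
    f (yxrCoeff q X Y k l a b) =
      yxrCoeff q (fun k => (X k).map f) (fun k => (Y k).map f) k l a b := by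
  obtain ⟨a, a'⟩ := a
  obtain ⟨b, b'⟩ := b
  simp [yxrCoeff_apply]

/-- The exchange relation in terms of coefficients; `i k` and `j l` are the exponents of the two
variables corresponding to `uᵏ` and `vˡ`, up to a shift. -/
theorem rtt_iff_coeff {q : ℂ} {α β : A⟦X⟧⟦X⟧} (hs : Spectral q α β) {n : ℕ}
    {M N : Matrix (Fin n) (Fin n) A⟦X⟧} {i j : ℤ → ℤ} (hi : Function.Surjective i)
    (hj : Function.Surjective j) {X Y : ℤ → Matrix (Fin n) (Fin n) A}
    (h1 : ∀ k l a b c d, intCoeff₂ (i k) (j l) (α * (inner (M a c) * outer (N b d))) =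
      X (k - 1) a c * Y l b d)
    (h2 : ∀ k l a b c d, intCoeff₂ (i k) (j l) (β * (inner (M a c) * outer (N b d))) =
      X k a c * Y (l - 1) b d)
    (h3 : ∀ k l a b c d, intCoeff₂ (i k) (j l) (α * (outer (N b d) * inner (M a c))) =
      Y l b d * X (k - 1) a c)
    (h4 : ∀ k l a b c d, intCoeff₂ (i k) (j l) (β * (outer (N b d) * inner (M a c))) =
      Y (l - 1) b d * X k a c) :
    RTT q α β (M.map inner) (N.map outer) ↔
      ∀ k l a b, rxyCoeff q X Y k l a b = yxrCoeff q X Y k l a b := by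
  have e1 : ∀ k l a b c d, intCoeff₂ (i k) (j l) (rDiag q α β a b * (inner (M a c) * outer (N b d)) +
      rOff q α β a b * (inner (M b c) * outer (N a d))) = rxyCoeff q X Y k l (a, b) (c, d) := by
    intro k l a b c d
    rw [rxyCoeff_apply, rDiag_eq_smul, rOff_eq_smul]
    simp only [add_mul, smul_mul_assoc, map_add, map_smul, h1, h2]
    abel
  have e2 : ∀ k l a b c d, intCoeff₂ (i k) (j l) (outer (N b d) * inner (M a c) * rDiag q α β c d +
      outer (N b c) * inner (M a d) * rOff q α β d c) = yxrCoeff q X Y k l (a, b) (c, d) := by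
    intro k l a b c d
    rw [yxrCoeff_apply, ← (hs.rDiag_comm _ _ _).eq, ← (hs.rOff_comm _ _ _).eq, rDiag_eq_smul,
      rOff_eq_smul]
    simp only [add_mul, smul_mul_assoc, map_add, map_smul, h3, h4]
    abel
  constructor
  · rintro h k l ⟨a, b⟩ ⟨c, d⟩
    rw [← e1, ← e2]
    exact congrArg _ (h a b c d)
  · intro h a b c d
    refine ext_intCoeff₂ fun k l => ?_
    obtain ⟨k, rfl⟩ := hi k
    obtain ⟨l, rfl⟩ := hj l
    have := h k l (a, b) (c, d)
    rw [← e1, ← e2] at this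
    exact this

/-- The coefficients of a matrix of series in `u⁻¹`, indexed by powers of `u`. -/
def negCoeff {n : ℕ} (M : Matrix (Fin n) (Fin n) A⟦X⟧) (k : ℤ) : Matrix (Fin n) (Fin n) A :=
  Matrix.of fun a b => intCoeff (M a b) (-k)

/-- The coefficients of a matrix of series in `u`, indexed by powers of `u`. -/
def posCoeff {n : ℕ} (M : Matrix (Fin n) (Fin n) A⟦X⟧) (k : ℤ) : Matrix (Fin n) (Fin n) A :=
  Matrix.of fun a b => intCoeff (M a b) k

/-- With x = u⁻¹ and one extra factor x clearing the denominator of R, the power uᵏ corresponds to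
x^{1−k}. -/
theorem surjective_one_sub : Function.Surjective fun k : ℤ => 1 - k := fun k => ⟨1 - k, by simp⟩

theorem rtt_neg_iff {q : ℂ} (hq : q ≠ 0) {n : ℕ} {M N : Matrix (Fin n) (Fin n) A⟦X⟧} :
    RTT q varY varX (M.map inner) (N.map outer) ↔
      ∀ k l a b, rxyCoeff q (negCoeff M) (negCoeff N) k l a b =
        yxrCoeff q (negCoeff M) (negCoeff N) k l a b := by
  apply rtt_iff_coeff (spectral_linear hq).symm surjective_one_sub surjective_one_sub
  all_goals
    intro k l a b c d
    simp only [intCoeff₂_varX_mul, intCoeff₂_varY_mul, intCoeff₂_inner_mul_outer,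
      intCoeff₂_outer_mul_inner, negCoeff, Matrix.of_apply]
    ring_nf

theorem rtt_pos_iff {q : ℂ} (hq : q ≠ 0) {n : ℕ} {M N : Matrix (Fin n) (Fin n) A⟦X⟧} :
    RTT q varX varY (M.map inner) (N.map outer) ↔
      ∀ k l a b, rxyCoeff q (posCoeff M) (posCoeff N) k l a b =
        yxrCoeff q (posCoeff M) (posCoeff N) k l a b := by
  apply rtt_iff_coeff (spectral_linear hq) Function.surjective_id Function.surjective_id
  all_goals
    intro k l a b c d
    simp only [intCoeff₂_varX_mul, intCoeff₂_varY_mul, intCoeff₂_inner_mul_outer,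
      intCoeff₂_outer_mul_inner, posCoeff, Matrix.of_apply, id]

theorem rtt_mixed_iff {q : ℂ} (hq : q ≠ 0) {n : ℕ} {M N : Matrix (Fin n) (Fin n) A⟦X⟧} :
    RTT q (varX * varY) 1 (M.map inner) (N.map outer) ↔
      ∀ k l a b, rxyCoeff q (posCoeff M) (negCoeff N) k l a b =
        yxrCoeff q (posCoeff M) (negCoeff N) k l a b := by
  apply rtt_iff_coeff (spectral_quadratic hq) Function.surjective_id surjective_one_sub
  all_goals
    intro k l a b c d
    simp only [mul_assoc, one_mul, intCoeff₂_varX_mul, intCoeff₂_varY_mul,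
      intCoeff₂_inner_mul_outer, intCoeff₂_outer_mul_inner, posCoeff, negCoeff, Matrix.of_apply, id]
    try ring_nf

end Coefficients

/-! ### Solutions of the defining relations of the quantum affine algebra -/

section Affine

variable {A : Type*} [Ring A] [Algebra ℂ A]

open PowerSeries

/-- A pair of matrices of series subject to the defining relations of the quantum affine
algebra. -/
structure AffinePair (q : ℂ) {n : ℕ} (T T' : Matrix (Fin n) (Fin n) A⟦X⟧) : Prop where
  rtt : RTT q varY varX (T.map inner) (T.map outer)
  rtt_bar : RTT q varX varY (T'.map inner) (T'.map outer)
  rtt_mixed : RTT q (varX * varY) 1 (T'.map inner) (T.map outer)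
  lower : ∀ i j, i < j → constantCoeff (T i j) = 0
  upper : ∀ i j, i < j → constantCoeff (T' j i) = 0
  mul_bar : ∀ i, constantCoeff (T i i) * constantCoeff (T' i i) = 1
  bar_mul : ∀ i, constantCoeff (T' i i) * constantCoeff (T i i) = 1

variable {q : ℂ} {n m s : ℕ} {T T' : Matrix (Fin n) (Fin n) A⟦X⟧}

theorem AffinePair.isLax (h : AffinePair q T T') (hq : q ≠ 0) (hq2 : q ^ 2 ≠ 1) :
    IsLax q (q ^ 2) varY varX T where
  q_ne := hq
  q_sq_ne := hq2
  spectral := (spectral_linear hq).symm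
  specializes := ⟨_, specializesTo_varY_varX hq⟩
  rtt := h.rtt
  triangular := ⟨Or.inl h.lower, fun i => ⟨⟨_, _, h.mul_bar i, h.bar_mul i⟩, rfl⟩⟩

theorem AffinePair.isLax_bar (h : AffinePair q T T') (hq : q ≠ 0) (hq2 : q ^ 2 ≠ 1) :
    IsLax q (q ^ 2)⁻¹ varX varY T' where
  q_ne := hq
  q_sq_ne := hq2
  spectral := spectral_linear hq
  specializes := ⟨_, specializesTo_varX_varY⟩
  rtt := h.rtt_bar
  triangular := ⟨Or.inr h.upper, fun i => ⟨⟨_, _, h.bar_mul i, h.mul_bar i⟩, rfl⟩⟩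

theorem AffinePair.laxPair (h : AffinePair q T T') (hq : q ≠ 0) (hq2 : q ^ 2 ≠ 1) :
    LaxPair q (q ^ 2)⁻¹ (q ^ 2) (varX * varY) 1 T' T where
  left := ⟨_, _, h.isLax_bar hq hq2⟩
  right := ⟨_, _, h.isLax hq hq2⟩
  spectral := spectral_quadratic hq
  rtt := h.rtt_mixed

/-- T̄ is a series in u itself, so the shift u ↦ q⁻²u is X ↦ q⁻²X there, but X ↦ q²X for T. -/
theorem AffinePair.flat (h : AffinePair q T T') (hq : q ≠ 0) (hq2 : q ^ 2 ≠ 1)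
    {P : Fin m → Fin n} {Q : Fin s → Fin n} (c : IsCut P Q) :
    AffinePair q (flat q (q ^ 2) T P Q) (flat q (q ^ 2)⁻¹ T' P Q) := by
  have h1 := h.isLax hq hq2
  have h2 := h.isLax_bar hq hq2
  have h3 := h.laxPair hq hq2
  have hp : (q ^ 2) ^ s ≠ 0 := pow_ne_zero _ (pow_ne_zero _ hq)
  have hp' : ((q ^ 2)⁻¹) ^ s ≠ 0 := pow_ne_zero _ (inv_ne_zero (pow_ne_zero _ hq))
  have hd : constantCoeff (minor q (q ^ 2)⁻¹ T' Q Q) * constantCoeff (minor q (q ^ 2) T Q Q) = 1 :=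
    (h3.submatrix c.mono_right).constantCoeff_minor_mul fun i => h.bar_mul _
  have hd' : constantCoeff (minor q (q ^ 2) T Q Q) * constantCoeff (minor q (q ^ 2)⁻¹ T' Q Q) = 1 := by
    rw [← (constantCoeff_commute (h3.coeffCommute_minor_of_strictMono c.mono_right)).eq, hd]
  refine
    { rtt := h1.laxPair.rtt_flat c ⟨_, hp, scaleBoth_varY _ _, scaleBoth_varX _ _⟩
      rtt_bar := h2.laxPair.rtt_flat c ⟨_, hp', scaleBoth_varX _ _, scaleBoth_varY _ _⟩
      rtt_mixed := h3.rtt_flat c ⟨1, one_ne_zero, ?_, ?_⟩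
      lower := fun i j hij => ?_
      upper := fun i j hij => ?_
      mul_bar := fun i => ?_
      bar_mul := fun i => h3.constantCoeff_flat_mul c h.bar_mul hd i }
  -- The opposite shifts of x = u and y = v⁻¹ leave xy unchanged, so the mixed parameters are
  -- invariant.
  · rw [map_mul, scaleBoth_varX, scaleBoth_varY, smul_mul_smul_comm, ← mul_pow,
      inv_mul_cancel₀ (pow_ne_zero _ hq), one_pow]
  · rw [map_one, one_smul]
  · rw [QuantumSylvester.flat, Matrix.of_apply, h1.constantCoeff_minor_cons c,
      h.lower _ _ (c.mono_left hij), mul_zero]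
  · rw [QuantumSylvester.flat, Matrix.of_apply, h2.constantCoeff_minor_cons c,
      h.upper _ _ (c.mono_left hij), mul_zero]
  · have hc := constantCoeff_commute (h3.coeffCommute_minor_schur c i i)
    rw [h1.triangular.constantCoeff_schur c.lt] at hc
    simp only [QuantumSylvester.flat, Matrix.of_apply, h1.constantCoeff_minor_cons c,
      h2.constantCoeff_minor_cons c]
    rw [mul_assoc, ← mul_assoc (constantCoeff (T _ _)), ← hc.eq, mul_assoc, h.mul_bar, mul_one, hd']

/-- The evaluation of the generators at the coefficients of a pair of matrices. -/
def evalGen (T T' : Matrix (Fin n) (Fin n) A⟦X⟧) : FreeAlgebra ℂ (Gen n) →ₐ[ℂ] A :=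
  FreeAlgebra.lift ℂ fun g => match g with
    | Gen.t i j r => coeff r (T i j)
    | Gen.tbar i j r => coeff r (T' i j)

theorem evalGen_t (T T' : Matrix (Fin n) (Fin n) A⟦X⟧) (i j : Fin n) (r : ℕ) :
    evalGen T T' (FreeAlgebra.ι ℂ (Gen.t i j r)) = coeff r (T i j) := by
  rw [evalGen, FreeAlgebra.lift_ι_apply]

theorem evalGen_tbar (T T' : Matrix (Fin n) (Fin n) A⟦X⟧) (i j : Fin n) (r : ℕ) :
    evalGen T T' (FreeAlgebra.ι ℂ (Gen.tbar i j r)) = coeff r (T' i j) := by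
  rw [evalGen, FreeAlgebra.lift_ι_apply]

theorem map_freeT {f : FreeAlgebra ℂ (Gen n) →ₐ[ℂ] A} {T : Matrix (Fin n) (Fin n) A⟦X⟧}
    (h : ∀ i j r, f (FreeAlgebra.ι ℂ (Gen.t i j r)) = coeff r (T i j)) :
    (fun k => (freeT n k).map f) = negCoeff T := by
  funext k
  refine Matrix.ext fun i j => ?_
  simp only [Matrix.map_apply, freeT, negCoeff, Matrix.of_apply, intCoeff, apply_ite f, h, map_zero]
  simp only [Int.neg_nonneg]

theorem map_freeTbar {f : FreeAlgebra ℂ (Gen n) →ₐ[ℂ] A} {T : Matrix (Fin n) (Fin n) A⟦X⟧}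
    (h : ∀ i j r, f (FreeAlgebra.ι ℂ (Gen.tbar i j r)) = coeff r (T i j)) :
    (fun k => (freeTbar n k).map f) = posCoeff T := by
  funext k
  refine Matrix.ext fun i j => ?_
  simp only [Matrix.map_apply, freeTbar, posCoeff, Matrix.of_apply, intCoeff, apply_ite f, h,
    map_zero]

theorem AffinePair.evalGen_rel (h : AffinePair q T T') (hq : q ≠ 0) ⦃x y : FreeAlgebra ℂ (Gen n)⦄
    (hxy : AffineRel q n x y) : evalGen T T' x = evalGen T T' y := by
  have e1 := map_freeT (evalGen_t T T')
  have e2 := map_freeTbar (evalGen_tbar T T')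
  cases hxy with
  | t_zero i j hij => simpa [evalGen_t] using h.lower i j hij
  | tbar_zero i j hij => simpa [evalGen_tbar] using h.upper i j hij
  | t_mul_tbar i => simpa [evalGen_t, evalGen_tbar] using h.mul_bar i
  | tbar_mul_t i => simpa [evalGen_t, evalGen_tbar] using h.bar_mul i
  | rtt k l a b =>
    rw [map_rxyCoeff, map_yxrCoeff, e1]
    exact (rtt_neg_iff hq).1 h.rtt k l a b
  | rtt_bar k l a b =>
    rw [map_rxyCoeff, map_yxrCoeff, e2]
    exact (rtt_pos_iff hq).1 h.rtt_bar k l a b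
  | rtt_mixed k l a b =>
    rw [map_rxyCoeff, map_yxrCoeff, e1, e2]
    exact (rtt_mixed_iff hq).1 h.rtt_mixed k l a b

/-- The homomorphism defined by a solution of the defining relations. -/
def AffinePair.lift (h : AffinePair q T T') (hq : q ≠ 0) : UqAffine q n →ₐ[ℂ] A :=
  RingQuot.liftAlgHom ℂ ⟨evalGen T T', h.evalGen_rel hq⟩

theorem AffinePair.lift_affT (h : AffinePair q T T') (hq : q ≠ 0) (i j : Fin n) (r : ℕ) :
    h.lift hq (affT q n i j r) = coeff r (T i j) := by
  rw [lift, affT, RingQuot.liftAlgHom_mkAlgHom_apply, evalGen_t]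

theorem AffinePair.lift_affTbar (h : AffinePair q T T') (hq : q ≠ 0) (i j : Fin n) (r : ℕ) :
    h.lift hq (affTbar q n i j r) = coeff r (T' i j) := by
  rw [lift, affTbar, RingQuot.liftAlgHom_mkAlgHom_apply, evalGen_tbar]

/-- The generator matrix `T(u)` over the quantum affine algebra. -/
def affMatrix (q : ℂ) (n : ℕ) : Matrix (Fin n) (Fin n) (UqAffine q n)⟦X⟧ :=
  Matrix.of fun i j => PowerSeries.mk fun r => affT q n i j r

/-- The generator matrix `T̄(u)` over the quantum affine algebra. -/
def affMatrixBar (q : ℂ) (n : ℕ) : Matrix (Fin n) (Fin n) (UqAffine q n)⟦X⟧ :=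
  Matrix.of fun i j => PowerSeries.mk fun r => affTbar q n i j r

theorem affinePair_affMatrix {q : ℂ} (hq : q ≠ 0) (n : ℕ) :
    AffinePair q (affMatrix q n) (affMatrixBar q n) := by
  have e1 := map_freeT (f := RingQuot.mkAlgHom ℂ (AffineRel q n)) (T := affMatrix q n)
    fun i j r => by simp [affMatrix, affT]
  have e2 := map_freeTbar (f := RingQuot.mkAlgHom ℂ (AffineRel q n)) (T := affMatrixBar q n)
    fun i j r => by simp [affMatrixBar, affTbar]
  have hT : ∀ i j, constantCoeff (affMatrix q n i j) = affT q n i j 0 := fun i j => by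
    simp [affMatrix, ← coeff_zero_eq_constantCoeff_apply]
  have hT' : ∀ i j, constantCoeff (affMatrixBar q n i j) = affTbar q n i j 0 := fun i j => by
    simp [affMatrixBar, ← coeff_zero_eq_constantCoeff_apply]
  constructor
  · rw [rtt_neg_iff hq, ← e1]
    intro k l a b
    rw [← map_rxyCoeff, ← map_yxrCoeff]
    exact RingQuot.mkAlgHom_rel ℂ (AffineRel.rtt k l a b)
  · rw [rtt_pos_iff hq, ← e2]
    intro k l a b
    rw [← map_rxyCoeff, ← map_yxrCoeff]
    exact RingQuot.mkAlgHom_rel ℂ (AffineRel.rtt_bar k l a b)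
  · rw [rtt_mixed_iff hq, ← e1, ← e2]
    intro k l a b
    rw [← map_rxyCoeff, ← map_yxrCoeff]
    exact RingQuot.mkAlgHom_rel ℂ (AffineRel.rtt_mixed k l a b)
  · intro i j hij
    rw [hT, affT, RingQuot.mkAlgHom_rel ℂ (AffineRel.t_zero i j hij), map_zero]
  · intro i j hij
    rw [hT', affTbar, RingQuot.mkAlgHom_rel ℂ (AffineRel.tbar_zero i j hij), map_zero]
  · intro i
    rw [hT, hT', affT, affTbar, ← map_mul, RingQuot.mkAlgHom_rel ℂ (AffineRel.t_mul_tbar i), map_one]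
  · intro i
    rw [hT, hT', affT, affTbar, ← map_mul, RingQuot.mkAlgHom_rel ℂ (AffineRel.tbar_mul_t i), map_one]

end Affine

/-! ### Restriction to the q-Yangian -/

section Subalgebra

variable {A A' : Type*} [Ring A] [Algebra ℂ A] [Ring A'] [Algebra ℂ A']

open PowerSeries

theorem map_scale (f : A →ₐ[ℂ] A') (c : ℂ) (x : A⟦X⟧) :
    mapAlgHom f (scale c x) = scale c (mapAlgHom f x) := by
  ext r
  simp [mapAlgHom_apply]

theorem map_minor (f : A →ₐ[ℂ] A') (q p : ℂ) {n r : ℕ} (M : Matrix (Fin n) (Fin n) A⟦X⟧)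
    (a b : Fin r → Fin n) :
    mapAlgHom f (minor q p M a b) = minor q p (M.map (mapAlgHom f)) a b := by
  simp only [minor, minorTerm, map_sum, map_smul, map_list_prod, List.map_ofFn, Matrix.map_apply,
    Function.comp_def, map_scale]

theorem mapAlgHom_val_injective (S : Subalgebra ℂ A) :
    Function.Injective (mapAlgHom S.val : S⟦X⟧ →ₐ[ℂ] A⟦X⟧) := by
  intro f g h
  ext r
  simpa [mapAlgHom_apply] using congrArg (coeff r) h

/-- By triangularity the constant term of the quantum determinant is the product of the diagonal
constant terms. -/
theorem IsLax.constantCoeff_minor_mem {q p : ℂ} {α β : A⟦X⟧⟦X⟧} {n : ℕ}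
    {M : Matrix (Fin n) (Fin n) A⟦X⟧} (h : IsLax q p α β M) {S : Subalgebra ℂ A}
    (hS : ∀ i, constantCoeff (M i i) ∈ S) : constantCoeff (minor q p M id id) ∈ S := by
  induction n with
  | zero => simp [minor_zero, one_mem]
  | succ n ih =>
    rw [h.constantCoeff_minor_id_succ]
    exact mul_mem (ih (h.submatrix Fin.strictMono_succ) fun i => hS i.succ) (hS 0)

theorem flatMatrix_eq_flat (q : ℂ) {m n : ℕ} (hmn : m ≤ n) (M : Matrix (Fin n) (Fin n) A⟦X⟧) :
    flatMatrix q hmn M = flat q (q ^ 2) M (Fin.castLE hmn) (lastIdx hmn) :=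
  Matrix.ext fun _ _ => qMinor_eq_minor q M _ _

theorem yangMatrix_map_val (q : ℂ) (n : ℕ) :
    (yangMatrix q n).map (mapAlgHom (qYangian q n).val) = affMatrix q n := by
  refine Matrix.ext fun i j => ?_
  ext r
  simp [mapAlgHom_apply, yangMatrix, affMatrix, yangT]

theorem isCut_castLE_lastIdx {m n : ℕ} (hmn : m ≤ n) :
    IsCut (Fin.castLE hmn) (lastIdx hmn) :=
  isCut_of_val (by omega) (fun _ => rfl) fun _ => rfl

theorem mapAlgHom_val_scale (S : Subalgebra ℂ A) (c : ℂ) (x : S⟦X⟧) :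
    mapAlgHom S.val (scale c x) = scale c (mapAlgHom S.val x) :=
  map_scale S.val c x

theorem mapAlgHom_val_minor (q p : ℂ) {n r : ℕ} (a b : Fin r → Fin n) :
    mapAlgHom (qYangian q n).val (minor q p (yangMatrix q n) a b) =
      minor q p (affMatrix q n) a b := by
  rw [← yangMatrix_map_val]
  exact map_minor (qYangian q n).val q p (yangMatrix q n) a b

theorem mapAlgHom_val_minor_flat (q p : ℂ) {n m s r : ℕ} (P : Fin m → Fin n) (Q : Fin s → Fin n)
    (a b : Fin r → Fin m) :
    mapAlgHom (qYangian q n).val (minor q p (flat q p (yangMatrix q n) P Q) a b) =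
      minor q p (flat q p (affMatrix q n) P Q) a b := by
  have e : (flat q p (yangMatrix q n) P Q).map (mapAlgHom (qYangian q n).val) =
      flat q p (affMatrix q n) P Q := Matrix.ext fun _ _ => mapAlgHom_val_minor q p _ _
  rw [← e]
  exact map_minor (qYangian q n).val q p (flat q p (yangMatrix q n) P Q) a b

theorem coeff_flat_mem (q : ℂ) {m n : ℕ} (hmn : m ≤ n) (i j : Fin m) (r : ℕ) :
    coeff r (flat q (q ^ 2) (affMatrix q n) (Fin.castLE hmn) (lastIdx hmn) i j) ∈
      qYangian q n := by
  rw [flat, Matrix.of_apply, ← mapAlgHom_val_minor, mapAlgHom_apply, coeff_map]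
  exact Subtype.prop _

theorem constantCoeff_flat_bar_mem {q : ℂ} (hq0 : q ≠ 0) (hq2 : q ^ 2 ≠ 1) {m n : ℕ}
    (hmn : m ≤ n) (i : Fin m) :
    constantCoeff (flat q (q ^ 2)⁻¹ (affMatrixBar q n) (Fin.castLE hmn) (lastIdx hmn) i i) ∈
      qYangian q n := by
  have h := (affinePair_affMatrix hq0 n).isLax_bar hq0 hq2
  have c := isCut_castLE_lastIdx hmn
  have hgen : ∀ i, constantCoeff (affMatrixBar q n i i) ∈ qYangian q n := fun i =>
    Algebra.subset_adjoin (Or.inr ⟨i, by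
      simp [affMatrixBar, ← coeff_zero_eq_constantCoeff_apply]⟩)
  rw [flat, Matrix.of_apply, h.constantCoeff_minor_cons c]
  refine mul_mem ?_ (hgen _)
  have := (h.submatrix c.mono_right).constantCoeff_minor_mem (S := qYangian q n)
    fun i => hgen (lastIdx hmn i)
  rwa [minor_submatrix] at this

/-- The map comes from the presentation of the full affine algebra; only the images of the
generators of the q-Yangian have to be located. -/
theorem exists_map_flatMatrix {q : ℂ} (hq0 : q ≠ 0) (hq2 : q ^ 2 ≠ 1) {m n : ℕ} (hmn : m ≤ n) :
    ∃ φ : qYangian q m →ₐ[ℂ] qYangian q n, ∀ i j : Fin m,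
      PowerSeries.map (φ : qYangian q m →+* qYangian q n) (yangMatrix q m i j) =
        flatMatrix q hmn (yangMatrix q n) i j := by
  have hflat := (affinePair_affMatrix hq0 n).flat hq0 hq2 (isCut_castLE_lastIdx hmn)
  have hle : qYangian q m ≤ (qYangian q n).comap (hflat.lift hq0) := by
    refine Algebra.adjoin_le ?_
    rintro _ (⟨i, j, r, rfl⟩ | ⟨i, rfl⟩)
    · rw [SetLike.mem_coe, Subalgebra.mem_comap, hflat.lift_affT]
      exact coeff_flat_mem q hmn i j r
    · rw [SetLike.mem_coe, Subalgebra.mem_comap, hflat.lift_affTbar,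
        coeff_zero_eq_constantCoeff_apply]
      exact constantCoeff_flat_bar_mem hq0 hq2 hmn i
  refine ⟨((hflat.lift hq0).comp (qYangian q m).val).codRestrict (qYangian q n)
    fun x => hle x.2, fun i j => ?_⟩
  apply mapAlgHom_val_injective (qYangian q n)
  rw [flatMatrix, Matrix.of_apply, qMinor_eq_minor, mapAlgHom_val_minor]
  ext r
  refine Eq.trans ?_ (hflat.lift_affT hq0 i j r)
  simp [mapAlgHom_apply, yangMatrix, yangT]
  rfl

/-- The remaining generators t̄_ii^(0) are two-sided inverses of t_ii^(0), so their images are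
forced. -/
theorem qYangian_algHom_ext {q : ℂ} (hq0 : q ≠ 0) {m : ℕ} {B : Type*} [Semiring B] [Algebra ℂ B]
    {φ ψ : qYangian q m →ₐ[ℂ] B} (h : ∀ i j r, φ (yangT q m i j r) = ψ (yangT q m i j r)) :
    φ = ψ := by
  refine AlgHom.adjoin_ext ?_
  rintro _ (⟨i, j, r, rfl⟩ | ⟨i, rfl⟩)
  · exact h i j r
  · have hp := affinePair_affMatrix hq0 m
    have h1 := hp.mul_bar i
    have h2 := hp.bar_mul i
    simp only [affMatrix, affMatrixBar, Matrix.of_apply, ← coeff_zero_eq_constantCoeff_apply,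
      coeff_mk] at h1 h2
    let y : qYangian q m := ⟨affTbar q m i i 0, Algebra.subset_adjoin (Or.inr ⟨i, rfl⟩)⟩
    have e1 : yangT q m i i 0 * y = 1 := Subtype.ext h1
    have e2 : y * yangT q m i i 0 = 1 := Subtype.ext h2
    have e3 : φ y * φ (yangT q m i i 0) = 1 := by rw [← map_mul, e2, map_one]
    have e4 : φ (yangT q m i i 0) * ψ y = 1 := by rw [h, ← map_mul, e1, map_one]
    exact left_inv_eq_right_inv e3 e4

/-- The identity is verified over the affine algebra; coefficientwise inclusion of the q-Yangian is
injective and preserves minors. -/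
theorem qDet_flatMatrix {q : ℂ} (hq0 : q ≠ 0) (hq2 : q ^ 2 ≠ 1) {m n : ℕ} (hm : 1 ≤ m)
    (hmn : m ≤ n) :
    qDet q (flatMatrix q hmn (yangMatrix q n)) = qDet q (yangMatrix q n) *
      (List.ofFn fun k : Fin (m - 1) => scaleArg (q ^ (-2 * ((k : ℤ) + 1)))
        (qDet q (lastBlock hmn (yangMatrix q n)))).prod := by
  have key := ((affinePair_affMatrix hq0 n).isLax hq0 hq2).minor_flat hm
    (P := Fin.castLE hmn) (Q := lastIdx hmn) (by omega) (fun _ => rfl) fun _ => rfl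
  have hs : ∀ k : ℕ, (q ^ (-2 * ((k : ℤ) + 1)))⁻¹ = (q ^ 2) ^ (k + 1) := fun k => by
    rw [← zpow_neg, neg_mul, neg_neg, zpow_mul]
    norm_cast
  apply mapAlgHom_val_injective (qYangian q n)
  simp only [qDet, qMinor_eq_minor, flatMatrix_eq_flat, map_mul, mapAlgHom_val_minor,
    mapAlgHom_val_minor_flat, map_list_prod, List.map_ofFn, Function.comp_def, scaleArg_eq_scale,
    mapAlgHom_val_scale, hs, lastBlock, minor_submatrix, id_eq]
  exact key

end Subalgebra

end QuantumSylvester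

end

theorem theorem3p6 (q : ℂ) (hq0 : q ≠ 0) (hq : ∀ k : ℕ, 0 < k → q ^ k ≠ 1)
    (m n : ℕ) (hm : 1 ≤ m) (hmn : m ≤ n) :
    (∃! φ : QuantumSylvester.qYangian q m →ₐ[ℂ] QuantumSylvester.qYangian q n,
      ∀ i j : Fin m,
        PowerSeries.map (φ : QuantumSylvester.qYangian q m →+* QuantumSylvester.qYangian q n)
            (QuantumSylvester.yangMatrix q m i j) =
          QuantumSylvester.flatMatrix q hmn (QuantumSylvester.yangMatrix q n) i j) ∧
    QuantumSylvester.qDet q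
        (QuantumSylvester.flatMatrix q hmn (QuantumSylvester.yangMatrix q n)) =
      QuantumSylvester.qDet q (QuantumSylvester.yangMatrix q n) *
        (List.ofFn fun k : Fin (m - 1) =>
          QuantumSylvester.scaleArg (q ^ (-2 * ((k : ℤ) + 1)))
            (QuantumSylvester.qDet q
              (QuantumSylvester.lastBlock hmn (QuantumSylvester.yangMatrix q n)))).prod := by
  have hq2 : q ^ 2 ≠ 1 := hq 2 two_pos
  obtain ⟨φ, hφ⟩ := QuantumSylvester.exists_map_flatMatrix hq0 hq2 hmn
  refine ⟨⟨φ, hφ, fun ψ hψ => QuantumSylvester.qYangian_algHom_ext hq0 fun i j r => ?_⟩,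
    QuantumSylvester.qDet_flatMatrix hq0 hq2 hm hmn⟩
  have h := congrArg (PowerSeries.coeff r) ((hψ i j).trans (hφ i j).symm)
  simpa [QuantumSylvester.yangMatrix] using h
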